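/- Let $\mathbb S^1=\mathbb R/\mathbb Z$ and let $\alpha\in\mathbb R$ be a Liouville number, i.e. for every $n\in\mathbb N$ there are integers $p,q$ with $q>1$ and $0<|\alpha-p/q|<q^{-n}$. Let $\mathcal H^\infty_\alpha$ be the set of orientation-preserving $C^\infty$ diffeomorphisms of $\mathbb S^1$ with rotation number $\alpha \bmod 1$, equipped with the metric $$d_\infty(f,g)=\sum_{k\ge 1}\frac{d_k(f,g)}{2^k(1+d_k(f,g))},\qquad d_k(f,g)=\max\{\|f-g\|_k,\ \|f^{-1}-g^{-1}\|_k\},$$ where $\|f-g\|_k=\max_{0\le i\le k}\sup_x|D^i(f-g)(x)|$ (for $i=0$ the circle distance of $f(x)$ and $g(x)$; for $i\ge1$ derivatives of lifts). Let $E_0$ be the equivalence relation on $\{0,1\}^{\mathbb N}$ (with the product topology) given by $a\,E_0\,b$ iff there is $N$ with $a_m=b_m$ for all $m>N$. Then there is a continuous map $\Psi:\{0,1\}^{\mathbb N}\to\mathcal H^\infty_\alpha$ such that for every collection $\mathcal D$ of orientation-preserving circle homeomorphisms given by a degree of regularity from Hölder to $C^\infty$, i.e. every $\mathcal D$ that contains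 all orientation-preserving $C^\infty$ diffeomorphisms of $\mathbb S^1$ and consists of Hölder continuous (of some exponent $\beta\in(0,1]$) orientation-preserving homeomorphisms, $\Psi$ is a reduction of $E_0$ to the $\mathcal D$-conjugacy relation on $\mathcal H^\infty_\alpha$: for all $a,b\in\{0,1\}^{\mathbb N}$, $$a\,E_0\,b\iff \Psi(a)=h\circ\Psi(b)\circ h^{-1}\ \text{ for some } h\in\mathcal D.$$ In particular this holds for $\mathcal D$ the class of all Hölder homeomorphisms, of $C^k$ diffeomorphisms ($1\le k\le\infty$), and of class $C^{k+\beta}$ ($k\ge0$, $0<\beta\le 1$). -/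

import Mathlib

open Set Filter Topology
open scoped NNReal ContDiff

namespace CircleConj

/-- The circle `ℝ / ℤ` (with its quotient metric). -/
abbrev Circ : Type := UnitAddCircle

/-! ### Lifts and rotation numbers -/

/-- `F` is a lift of the circle map `f`: a continuous increasing map of the line with
`F (x + 1) = F x + 1` and `π ∘ F = f ∘ π`. -/
def IsLift (F : CircleDeg1Lift) (f : Circ → Circ) : Prop :=
  Continuous F ∧ ∀ x : ℝ, ((F x : ℝ) : Circ) = f (x : Circ)

/-- A homeomorphism of the circle preserves orientation if it has an increasing lift. -/
def OrientationPreserving (f : Circ ≃ₜ Circ) : Prop :=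
  ∃ F : CircleDeg1Lift, IsLift F f

/-- Two lifts of the same map differ by an integer constant. -/
theorem IsLift.unique {F G : CircleDeg1Lift} {f : Circ → Circ} (hF : IsLift F f)
    (hG : IsLift G f) : ∃ m : ℤ, ∀ x : ℝ, F x = G x + m := by
  have hd : ∀ x : ℝ, F x - G x ∈ range ((↑) : ℤ → ℝ) := by
    intro x
    have h : ((F x - G x : ℝ) : Circ) = 0 := by
      rw [AddCircle.coe_sub, hF.2, hG.2, sub_self]
    rw [AddCircle.coe_eq_zero_iff] at h
    obtain ⟨n, hn⟩ := h
    exact ⟨n, by simpa using hn⟩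
  have hdisc : IsDiscrete (range ((↑) : ℤ → ℝ)) :=
    ⟨(Int.isClosedEmbedding_coe_real.toIsEmbedding.toHomeomorph.symm).isEmbedding.discreteTopology⟩
  obtain ⟨y, ⟨m, rfl⟩, hy⟩ := isPreconnected_univ.eqOn_const_of_mapsTo hdisc
    ((hF.1.sub hG.1).continuousOn (s := univ)) (fun x _ => hd x) ⟨0, 0, by simp⟩
  refine ⟨m, fun x => ?_⟩
  have := hy (mem_univ x)
  simp only [Pi.sub_apply, Function.const_apply] at this
  linarith

/-- A lift of `f`, whenever there is one. -/
noncomputable def lift (f : Circ → Circ) : CircleDeg1Lift :=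
  Classical.epsilon fun F => IsLift F f

theorem isLift_lift {f : Circ → Circ} (h : ∃ F : CircleDeg1Lift, IsLift F f) :
    IsLift (lift f) f :=
  Classical.epsilon_spec h

/-- The rotation number: the class modulo `1` of `lim (F^n x - x) / n`, for a lift `F` of `f`. -/
noncomputable def rotationNumber (f : Circ ≃ₜ Circ) : Circ :=
  (((lift f).translationNumber : ℝ) : Circ)

/-- The rotation number may be computed with any lift. -/
theorem rotationNumber_eq {F : CircleDeg1Lift} {f : Circ ≃ₜ Circ} (hF : IsLift F f) :
    rotationNumber f = ((F.translationNumber : ℝ) : Circ) := by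
  obtain ⟨m, hm⟩ := (isLift_lift ⟨F, hF⟩).unique hF
  have h1 : lift f =
      (CircleDeg1Lift.translate (Multiplicative.ofAdd (m : ℝ)) : CircleDeg1Lift) * F := by
    ext x
    rw [CircleDeg1Lift.mul_apply, CircleDeg1Lift.translate_apply, hm x, add_comm]
  have h2 : Commute (CircleDeg1Lift.translate (Multiplicative.ofAdd (m : ℝ)) : CircleDeg1Lift)
      F := by
    ext x
    rw [CircleDeg1Lift.mul_apply, CircleDeg1Lift.mul_apply, CircleDeg1Lift.translate_apply,
      CircleDeg1Lift.translate_apply, F.map_int_add]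
  rw [rotationNumber, h1, CircleDeg1Lift.translationNumber_mul_of_commute h2,
    CircleDeg1Lift.translationNumber_translate, AddCircle.coe_add]
  have : ((m : ℝ) : Circ) = 0 := (AddCircle.coe_eq_zero_iff 1).2 ⟨m, by simp⟩
  rw [this, zero_add]

/-! ### Regularity classes -/

/-- The orientation-preserving homeomorphisms that are `C^k` together with their inverses. -/
def Diffeo (k : ℕ∞) : Set (Circ ≃ₜ Circ) :=
  {f | (∃ F : CircleDeg1Lift, IsLift F f ∧ ContDiff ℝ k F) ∧
    ∃ G : CircleDeg1Lift, IsLift G f.symm ∧ ContDiff ℝ k G}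

/-- The orientation-preserving homeomorphisms that are Hölder continuous of some exponent. -/
def HolderHomeo : Set (Circ ≃ₜ Circ) :=
  {f | OrientationPreserving f ∧
    ∃ C β : ℝ≥0, 0 < β ∧ β ≤ 1 ∧ HolderWith C β f}

/-- The class `C^{k+β}`: the orientation-preserving `C^k` diffeomorphisms whose `k`-th derivative
is Hölder continuous of exponent `β` (for `k = 0` this is the map itself). -/
def DiffeoHolder (k : ℕ) (β : ℝ≥0) : Set (Circ ≃ₜ Circ) :=
  {f | f ∈ Diffeo k ∧
    if k = 0 then ∃ C : ℝ≥0, HolderWith C β f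
    else ∃ (F : CircleDeg1Lift) (C : ℝ≥0), IsLift F f ∧ HolderWith C β (iteratedDeriv k F)}

/-- The collection of homeomorphisms `𝒟` is given by a regularity between Hölder continuity and
infinite differentiability. -/
def IsRegularityClass (𝒟 : Set (Circ ≃ₜ Circ)) : Prop :=
  Diffeo ⊤ ⊆ 𝒟 ∧ 𝒟 ⊆ HolderHomeo

theorem diffeo_anti {k l : ℕ∞} (h : k ≤ l) : Diffeo l ⊆ Diffeo k := by
  rintro f ⟨⟨F, hF, hF'⟩, G, hG, hG'⟩
  have h' : (k : WithTop ℕ∞) ≤ l := by exact_mod_cast h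
  exact ⟨⟨F, hF, hF'.of_le h'⟩, G, hG, hG'.of_le h'⟩

/-- Derivatives of order at least one of a lift are `1`-periodic. -/
theorem iteratedDeriv_add_one (F : CircleDeg1Lift) {i : ℕ} (hi : i ≠ 0) (x : ℝ) :
    iteratedDeriv i F (x + 1) = iteratedDeriv i F x := by
  obtain ⟨j, rfl⟩ := Nat.exists_eq_succ_of_ne_zero hi
  have h : (fun z => iteratedDeriv (j + 1) F (z + 1)) = iteratedDeriv (j + 1) F := by
    rw [← iteratedDeriv_comp_add_const]
    have : (fun z => F (z + 1)) = fun z => F z + 1 := funext fun z => F.map_add_one z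
    rw [this]
    rw [iteratedDeriv_succ', iteratedDeriv_succ']
    congr 1
    ext z
    simp
  exact congrFun h x

theorem exists_bound_iteratedDeriv (F : CircleDeg1Lift) {i : ℕ} (hi : i ≠ 0)
    (hF : ContDiff ℝ i F) : ∃ C : ℝ, ∀ x, |iteratedDeriv i F x| ≤ C := by
  obtain ⟨C, hC⟩ := isCompact_Icc.exists_bound_of_continuousOn
    ((hF.continuous_iteratedDeriv i le_rfl).continuousOn (s := Icc (0 : ℝ) 1))
  refine ⟨C, fun x => ?_⟩
  have hp : Function.Periodic (iteratedDeriv i F) 1 := iteratedDeriv_add_one F hi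
  obtain ⟨y, hy, hxy⟩ := hp.exists_mem_Ico₀ one_pos x
  rw [hxy]
  exact hC y (Ico_subset_Icc_self hy)

/-- A `C^1` circle diffeomorphism is Lipschitz. -/
theorem exists_lipschitzWith_of_mem_diffeo {k : ℕ∞} (hk : 1 ≤ k) {f : Circ ≃ₜ Circ}
    (hf : f ∈ Diffeo k) : ∃ C : ℝ≥0, LipschitzWith C f := by
  obtain ⟨⟨F, hF, hF'⟩, -⟩ := diffeo_anti hk hf
  have hF1 : ContDiff ℝ 1 F := by exact_mod_cast hF'
  obtain ⟨C, hC⟩ := exists_bound_iteratedDeriv F one_ne_zero (by exact_mod_cast hF1)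
  have hC0 : 0 ≤ C := (abs_nonneg _).trans (hC 0)
  have hlip : LipschitzWith C.toNNReal F := by
    refine lipschitzWith_of_nnnorm_deriv_le (hF1.differentiable one_ne_zero) fun x => ?_
    rw [← NNReal.coe_le_coe, coe_nnnorm, Real.coe_toNNReal C hC0, Real.norm_eq_abs]
    simpa using hC x
  refine ⟨C.toNNReal, ?_⟩
  refine LipschitzWith.of_dist_le_mul fun x y => ?_
  obtain ⟨a, rfl⟩ := QuotientAddGroup.mk_surjective x
  obtain ⟨b, rfl⟩ := QuotientAddGroup.mk_surjective y
  change dist (f (a : Circ)) (f (b : Circ)) ≤ C.toNNReal * dist (a : Circ) (b : Circ)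
  have hb : ((b + (round (a - b) : ℤ) : ℝ) : Circ) = (b : Circ) := by
    rw [AddCircle.coe_add]
    have : (((round (a - b) : ℤ) : ℝ) : Circ) = 0 :=
      (AddCircle.coe_eq_zero_iff 1).2 ⟨round (a - b), by simp⟩
    rw [this, add_zero]
  have h1 : dist (a : Circ) (b : Circ) = dist a (b + (round (a - b) : ℤ)) := by
    rw [dist_eq_norm, ← AddCircle.coe_sub, UnitAddCircle.norm_eq, Real.dist_eq, sub_sub]
  have h2 : ∀ u v : ℝ, dist (u : Circ) (v : Circ) ≤ dist u v := by
    intro u v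
    rw [dist_eq_norm, ← AddCircle.coe_sub, UnitAddCircle.norm_eq, Real.dist_eq]
    simpa using round_le (u - v) 0
  rw [h1, ← hb, ← hF.2, ← hF.2]
  exact (h2 _ _).trans (hlip.dist_le_mul _ _)

/-- A `C^1` circle diffeomorphism is Hölder continuous. -/
theorem diffeo_subset_holderHomeo {k : ℕ∞} (hk : 1 ≤ k) : Diffeo k ⊆ HolderHomeo := by
  intro f hf
  obtain ⟨C, hC⟩ := exists_lipschitzWith_of_mem_diffeo hk hf
  obtain ⟨⟨F, hF, -⟩, -⟩ := hf
  exact ⟨⟨F, hF⟩, C, 1, one_pos, le_rfl, holderWith_one.2 hC⟩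

/-- A bounded Lipschitz map is Hölder continuous of every exponent in `[0, 1]`. -/
theorem exists_holderWith {X Y : Type*} [PseudoMetricSpace X] [PseudoMetricSpace Y] {g : X → Y}
    {L B β : ℝ≥0} (hL : LipschitzWith L g) (hB : ∀ x y, dist (g x) (g y) ≤ B) (hβ : β ≤ 1) :
    ∃ C : ℝ≥0, HolderWith C β g := by
  refine ⟨max L B, fun x y => ?_⟩
  rw [edist_nndist, edist_nndist, ← ENNReal.coe_rpow_of_nonneg _ β.coe_nonneg, ← ENNReal.coe_mul,
    ENNReal.coe_le_coe]
  rcases le_total (nndist x y) 1 with h | h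
  · calc nndist (g x) (g y) ≤ L * nndist x y := hL.nndist_le x y
      _ ≤ max L B * nndist x y ^ (β : ℝ) := by
        refine mul_le_mul' (le_max_left _ _) ?_
        rw [← NNReal.coe_le_coe, NNReal.coe_rpow]
        simpa using Real.rpow_le_rpow_of_exponent_ge' (nndist x y).coe_nonneg h β.coe_nonneg
          (show (β : ℝ) ≤ 1 by exact_mod_cast hβ)
  · calc nndist (g x) (g y) ≤ B * 1 := by
          rw [mul_one]
          exact hB x y
      _ ≤ max L B * nndist x y ^ (β : ℝ) :=
        mul_le_mul' (le_max_right _ _) (NNReal.one_le_rpow h β.coe_nonneg)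

theorem isRegularityClass_diffeo {k : ℕ∞} (hk : 1 ≤ k) : IsRegularityClass (Diffeo k) :=
  ⟨diffeo_anti le_top, diffeo_subset_holderHomeo hk⟩

theorem isRegularityClass_diffeoHolder (k : ℕ) {β : ℝ≥0} (hβ : 0 < β) (hβ' : β ≤ 1) :
    IsRegularityClass (DiffeoHolder k β) := by
  constructor
  · intro f hf
    refine ⟨diffeo_anti le_top hf, ?_⟩
    split_ifs with hk
    · obtain ⟨L, hL⟩ := exists_lipschitzWith_of_mem_diffeo le_top hf
      refine exists_holderWith (B := 1) hL (fun x y => ?_) hβ'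
      rw [dist_eq_norm]
      refine (AddCircle.norm_le_half_period (1 : ℝ) one_ne_zero).trans ?_
      norm_num
    · obtain ⟨⟨F, hF, hF'⟩, -⟩ := hf
      have hle : ∀ i : ℕ, ((i : ℕ) : WithTop ℕ∞) ≤ ((⊤ : ℕ∞) : WithTop ℕ∞) := fun i => by
        exact_mod_cast le_top
      obtain ⟨A, hA⟩ := exists_bound_iteratedDeriv F hk (hF'.of_le (hle k))
      obtain ⟨L, hL⟩ := exists_bound_iteratedDeriv F k.succ_ne_zero (hF'.of_le (hle (k + 1)))
      have hA0 : 0 ≤ A := (abs_nonneg _).trans (hA 0)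
      have hL0 : 0 ≤ L := (abs_nonneg _).trans (hL 0)
      have hlip : LipschitzWith L.toNNReal (iteratedDeriv k F) := by
        refine lipschitzWith_of_nnnorm_deriv_le
          (hF'.differentiable_iteratedDeriv k (by exact_mod_cast ENat.natCast_lt_top k)) fun x => ?_
        rw [← iteratedDeriv_succ, ← NNReal.coe_le_coe, coe_nnnorm, Real.coe_toNNReal L hL0,
          Real.norm_eq_abs]
        exact hL x
      obtain ⟨C, hC⟩ := exists_holderWith (B := (A + A).toNNReal) hlip (fun x y => by
        rw [Real.coe_toNNReal _ (by positivity), Real.dist_eq]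
        exact (abs_sub _ _).trans (add_le_add (hA x) (hA y))) hβ'
      exact ⟨F, C, hF, hC⟩
  · rintro f ⟨hf, hf'⟩
    rcases Nat.eq_zero_or_pos k with rfl | hk
    · rw [if_pos rfl] at hf'
      obtain ⟨C, hC⟩ := hf'
      obtain ⟨⟨F, hF, -⟩, -⟩ := hf
      exact ⟨⟨F, hF⟩, C, β, hβ, hβ', hC⟩
    · exact diffeo_subset_holderHomeo (by exact_mod_cast hk) hf

theorem isRegularityClass_holderHomeo : IsRegularityClass HolderHomeo :=
  ⟨diffeo_subset_holderHomeo le_top, subset_rfl⟩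

/-! ### The space of smooth circle diffeomorphisms -/

/-- `C^∞` orientation-preserving diffeomorphisms of the circle. -/
def SmoothDiffeo : Type := {f : Circ ≃ₜ Circ // f ∈ Diffeo ⊤}

/-- `sup_x |D^i (f - g) (x)|`; the difference `f - g` of two circle maps is measured in the
metric of the circle for `i = 0`, and through lifts for `i ≥ 1`. -/
noncomputable def derivDist (i : ℕ) (f g : Circ → Circ) : ℝ :=
  if i = 0 then ⨆ x : Circ, dist (f x) (g x)
  else ⨆ x : ℝ, |iteratedDeriv i (lift f) x - iteratedDeriv i (lift g) x|

/-- `‖f - g‖_k`, the maximum of the preceding quantities over `0 ≤ i ≤ k`. -/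
noncomputable def normDiff (k : ℕ) (f g : Circ → Circ) : ℝ :=
  ⨆ i : Fin (k + 1), derivDist i f g

/-- `d_k (f, g) = max (‖f - g‖_k, ‖f⁻¹ - g⁻¹‖_k)`. -/
noncomputable def distCk (k : ℕ) (f g : SmoothDiffeo) : ℝ :=
  max (normDiff k f.1 g.1) (normDiff k f.1.symm g.1.symm)

/-- `d_∞ (f, g) = ∑_{k ≥ 1} 2^{-k} d_k (f, g) / (1 + d_k (f, g))`. -/
noncomputable def distSmooth (f g : SmoothDiffeo) : ℝ :=
  ∑' k : ℕ, distCk (k + 1) f g / (2 ^ (k + 1) * (1 + distCk (k + 1) f g))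

/-- Maps with a smooth lift. -/
def HasSmoothLift (f : Circ → Circ) : Prop :=
  ∃ F : CircleDeg1Lift, IsLift F f ∧ ContDiff ℝ ∞ F

theorem SmoothDiffeo.hasSmoothLift (f : SmoothDiffeo) : HasSmoothLift f.1 := f.2.1

theorem SmoothDiffeo.hasSmoothLift_symm (f : SmoothDiffeo) : HasSmoothLift f.1.symm := f.2.2

theorem HasSmoothLift.contDiff_lift {f : Circ → Circ} (hf : HasSmoothLift f) :
    ContDiff ℝ ∞ (lift f) := by
  obtain ⟨F, hF, hF'⟩ := hf
  obtain ⟨m, hm⟩ := (isLift_lift ⟨F, hF⟩).unique hF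
  have : (lift f : ℝ → ℝ) = fun x => F x + m := funext hm
  rw [this]
  exact hF'.add contDiff_const

theorem bddAbove_dist (f g : Circ → Circ) :
    BddAbove (range fun x : Circ => dist (f x) (g x)) := by
  refine ⟨1 / 2, ?_⟩
  rintro _ ⟨x, rfl⟩
  simpa [dist_eq_norm] using AddCircle.norm_le_half_period (1 : ℝ) (x := f x - g x) one_ne_zero

theorem bddAbove_deriv {f g : Circ → Circ} (hf : HasSmoothLift f) (hg : HasSmoothLift g)
    {i : ℕ} (hi : i ≠ 0) :
    BddAbove (range fun x : ℝ =>
      |iteratedDeriv i (lift f) x - iteratedDeriv i (lift g) x|) := by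
  have hle : ((i : ℕ) : WithTop ℕ∞) ≤ ∞ := by exact_mod_cast le_top
  obtain ⟨A, hA⟩ := exists_bound_iteratedDeriv (lift f) hi (hf.contDiff_lift.of_le hle)
  obtain ⟨B, hB⟩ := exists_bound_iteratedDeriv (lift g) hi (hg.contDiff_lift.of_le hle)
  refine ⟨A + B, ?_⟩
  rintro _ ⟨x, rfl⟩
  exact (abs_sub _ _).trans (add_le_add (hA x) (hB x))

theorem derivDist_self (i : ℕ) (f : Circ → Circ) : derivDist i f f = 0 := by
  simp [derivDist]

theorem derivDist_comm (i : ℕ) (f g : Circ → Circ) : derivDist i f g = derivDist i g f := by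
  simp only [derivDist, dist_comm, abs_sub_comm]

theorem derivDist_nonneg (i : ℕ) (f g : Circ → Circ) : 0 ≤ derivDist i f g := by
  unfold derivDist
  split_ifs
  · exact Real.iSup_nonneg fun _ => dist_nonneg
  · exact Real.iSup_nonneg fun _ => abs_nonneg _

theorem derivDist_triangle (i : ℕ) {f g h : Circ → Circ} (hf : HasSmoothLift f)
    (hg : HasSmoothLift g) (hh : HasSmoothLift h) :
    derivDist i f h ≤ derivDist i f g + derivDist i g h := by
  unfold derivDist
  split_ifs with hi
  · exact ciSup_le fun x => (dist_triangle _ (g x) _).trans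
      (add_le_add (le_ciSup (bddAbove_dist f g) x) (le_ciSup (bddAbove_dist g h) x))
  · exact ciSup_le fun x => (abs_sub_le _ (iteratedDeriv i (lift g) x) _).trans
      (add_le_add (le_ciSup (bddAbove_deriv hf hg hi) x) (le_ciSup (bddAbove_deriv hg hh hi) x))

theorem derivDist_le_normDiff {i k : ℕ} (hik : i ≤ k) (f g : Circ → Circ) :
    derivDist i f g ≤ normDiff k f g :=
  le_ciSup (f := fun j : Fin (k + 1) => derivDist j f g) (finite_range _).bddAbove
    ⟨i, Nat.lt_succ_of_le hik⟩

theorem normDiff_triangle (k : ℕ) {f g h : Circ → Circ} (hf : HasSmoothLift f)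
    (hg : HasSmoothLift g) (hh : HasSmoothLift h) :
    normDiff k f h ≤ normDiff k f g + normDiff k g h :=
  ciSup_le fun i => (derivDist_triangle i hf hg hh).trans
    (add_le_add (derivDist_le_normDiff (Nat.le_of_lt_succ i.2) f g)
      (derivDist_le_normDiff (Nat.le_of_lt_succ i.2) g h))

theorem distCk_self (k : ℕ) (f : SmoothDiffeo) : distCk k f f = 0 := by
  simp [distCk, normDiff, derivDist_self]

theorem distCk_comm (k : ℕ) (f g : SmoothDiffeo) : distCk k f g = distCk k g f := by
  simp only [distCk, normDiff, derivDist_comm]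

theorem distCk_nonneg (k : ℕ) (f g : SmoothDiffeo) : 0 ≤ distCk k f g :=
  le_max_of_le_left (Real.iSup_nonneg fun _ => derivDist_nonneg _ _ _)

theorem distCk_triangle (k : ℕ) (f g h : SmoothDiffeo) :
    distCk k f h ≤ distCk k f g + distCk k g h :=
  max_le
    ((normDiff_triangle k f.hasSmoothLift g.hasSmoothLift h.hasSmoothLift).trans
      (add_le_add (le_max_left _ _) (le_max_left _ _)))
    ((normDiff_triangle k f.hasSmoothLift_symm g.hasSmoothLift_symm h.hasSmoothLift_symm).trans
      (add_le_add (le_max_right _ _) (le_max_right _ _)))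

theorem distSmooth_term_nonneg (k : ℕ) (f g : SmoothDiffeo) :
    0 ≤ distCk k f g / (2 ^ k * (1 + distCk k f g)) := by
  have := distCk_nonneg k f g
  positivity

theorem distSmooth_term_le (k : ℕ) (f g : SmoothDiffeo) :
    distCk k f g / (2 ^ k * (1 + distCk k f g)) ≤ (1 / 2 : ℝ) ^ k := by
  have := distCk_nonneg k f g
  rw [one_div, inv_pow, div_le_iff₀ (by positivity), ← mul_assoc,
    inv_mul_cancel₀ (by positivity), one_mul]
  linarith

theorem summable_distSmooth (f g : SmoothDiffeo) :
    Summable fun k : ℕ => distCk (k + 1) f g / (2 ^ (k + 1) * (1 + distCk (k + 1) f g)) :=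
  Summable.of_nonneg_of_le (fun k => distSmooth_term_nonneg (k + 1) f g)
    (fun k => distSmooth_term_le (k + 1) f g)
    ((summable_nat_add_iff 1).2 (summable_geometric_of_lt_one (by norm_num) (by norm_num)))

theorem distSmooth_term_triangle (k : ℕ) (f g h : SmoothDiffeo) :
    distCk k f h / (2 ^ k * (1 + distCk k f h)) ≤
      distCk k f g / (2 ^ k * (1 + distCk k f g)) +
        distCk k g h / (2 ^ k * (1 + distCk k g h)) := by
  have h1 := distCk_nonneg k f g
  have h2 := distCk_nonneg k g h
  have h3 := distCk_nonneg k f h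
  have h4 := distCk_triangle k f g h
  generalize distCk k f g = a at *
  generalize distCk k g h = b at *
  generalize distCk k f h = c at *
  have key : c / (1 + c) ≤ a / (1 + a) + b / (1 + b) := by
    rw [div_add_div _ _ (by positivity) (by positivity), div_le_div_iff₀ (by positivity)
      (by positivity)]
    nlinarith [mul_nonneg h1 h2, mul_nonneg (mul_nonneg h1 h2) h3]
  have e : ∀ t : ℝ, t / (2 ^ k * (1 + t)) = (2 ^ k : ℝ)⁻¹ * (t / (1 + t)) := by
    intro t
    rw [← div_div, div_eq_inv_mul t, mul_div_assoc]
  rw [e, e, e, ← mul_add]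
  exact mul_le_mul_of_nonneg_left key (by positivity)

/-- The metric `d_∞`. -/
noncomputable instance : MetricSpace SmoothDiffeo where
  dist := distSmooth
  dist_self f := by
    simp [distSmooth, distCk_self]
  dist_comm f g := by
    simp only [distSmooth, distCk_comm]
  dist_triangle f g h := by
    unfold distSmooth
    rw [← (summable_distSmooth f g).tsum_add (summable_distSmooth g h)]
    exact (summable_distSmooth f h).tsum_le_tsum
      (fun k => distSmooth_term_triangle (k + 1) f g h)
      ((summable_distSmooth f g).add (summable_distSmooth g h))
  eq_of_dist_eq_zero := by
    intro f g h
    change distSmooth f g = 0 at h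
    unfold distSmooth at h
    have h0 := ((summable_distSmooth f g).hasSum_iff.2 h)
    rw [hasSum_zero_iff_of_nonneg (fun k => distSmooth_term_nonneg (k + 1) f g)] at h0
    have h1 : distCk 1 f g = 0 := by
      have h2 := congrFun h0 0
      have h3 := distCk_nonneg 1 f g
      simp only [zero_add, Pi.zero_apply] at h2
      rcases div_eq_zero_iff.1 h2 with h4 | h4
      · exact h4
      · exfalso
        have : (0 : ℝ) < 2 ^ 1 * (1 + distCk 1 f g) := by positivity
        exact this.ne' h4
    apply Subtype.ext
    apply Homeomorph.ext
    intro x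
    apply dist_le_zero.1
    calc dist (f.1 x) (g.1 x) ≤ derivDist 0 f.1 g.1 := by
          simp only [derivDist, if_true]
          exact le_ciSup (bddAbove_dist f.1 g.1) x
      _ ≤ normDiff 1 f.1 g.1 := derivDist_le_normDiff zero_le_one _ _
      _ ≤ distCk 1 f g := le_max_left _ _
      _ = 0 := h1

/-- The smooth diffeomorphisms with rotation number `α`, with the subspace metric. -/
abbrev SmoothDiffeoRot (α : Circ) : Type := {f : SmoothDiffeo // rotationNumber f.1 = α}

/-! ### Relations and reductions -/

/-- `S` and `T` are `𝒟`-conjugate: `S = h ∘ T ∘ h⁻¹` for some `h ∈ 𝒟`. -/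
def ConjBy (𝒟 : Set (Circ ≃ₜ Circ)) (S T : Circ ≃ₜ Circ) : Prop :=
  ∃ h ∈ 𝒟, S = h * T * h⁻¹

/-- The `𝒟`-conjugacy relation on the smooth diffeomorphisms with rotation number `α`. -/
def conjRel (𝒟 : Set (Circ ≃ₜ Circ)) (α : Circ) (S T : SmoothDiffeoRot α) : Prop :=
  ConjBy 𝒟 S.1.1 T.1.1

/-- Eventual equality of binary sequences. -/
def E₀ (a b : ℕ → Bool) : Prop := ∃ N : ℕ, ∀ m > N, a m = b m

/-- `f` reduces the relation `E` to the relation `F`. -/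
def Reduces {X Y : Type*} (E : X → X → Prop) (F : Y → Y → Prop) (f : X → Y) : Prop :=
  ∀ x₁ x₂, E x₁ x₂ ↔ F (f x₁) (f x₂)

end CircleConj

/-! The construction is of Anosov–Katok type. Let `S_n = squeeze n (q n)`: a diffeomorphism that
commutes with the rotation by `1/q_n` and has slope `q_n^(-n)` on half of the circle. To a binary
sequence `a` belongs the infinite composition `H_a` of the `S_n⁻¹` with `a_n = 1` (`limWord`), and
the map `f_a = H_a R_α H_a⁻¹`, where `R_t` is translation by `t`.

Smoothness and continuity: because `S_n` commutes with `R_{p/q_n}`, the map `S_n⁻¹ R_α S_n` differs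
from `R_α` only by `|α - p/q_n|` times a power of `q_n` whose exponent does not depend on `q_n`
(`exists_derivBound_conj_sub`). For Liouville `α` this can be made as small as desired, for all of
the finitely many prefixes at once (`exists_goodSeq`). The conjugates by finite words then converge
geometrically in every `C^k`, uniformly in `a`, so `f_a` is smooth and depends continuously on `a`.

Reduction: if `a` and `b` have the same tail, `H_a H_b⁻¹` is a finite product of smooth maps and
conjugates `f_b` to `f_a` (`limWord_eq`). Conversely, only rotations commute with an irrational
rotation, so every conjugacy is `H_a R_t H_b⁻¹` (`eq_toCirc_of_conj`). When `a_n = 1` and `b_n = 0`,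
this map sends two points at distance at most `q_n^(-n)` to points at distance at least `1/(2 q_n²)`
(`exists_stretched_interval`); infinitely many such `n` exclude every Hölder exponent. The sequences
are first recoded by `interleave`, so that any two that are not `E₀`-equivalent have infinitely many
such `n` in this order. -/

namespace CircleConj

/-! ### Quantitative bounds on derivatives -/

/-- `u` is smooth and its derivatives of orders `l, …, k` are bounded by `A`. -/
def DerivBound (l k : ℕ) (u : ℝ → ℝ) (A : ℝ) : Prop :=
  ContDiff ℝ ∞ u ∧ ∀ i, l ≤ i → i ≤ k → ∀ x, |iteratedDeriv i u x| ≤ A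

namespace DerivBound

variable {l k : ℕ} {u v φ : ℝ → ℝ} {A B D : ℝ}

theorem mono (h : DerivBound l k u A) {l' k' : ℕ} {A' : ℝ} (hl : l ≤ l') (hk : k' ≤ k)
    (hA : A ≤ A') : DerivBound l' k' u A' :=
  ⟨h.1, fun i h1 h2 x => (h.2 i (hl.trans h1) (h2.trans hk) x).trans hA⟩

theorem nonneg (h : DerivBound l k u A) (hlk : l ≤ k) : 0 ≤ A :=
  (abs_nonneg _).trans (h.2 l le_rfl hlk 0)

theorem natCast_le_infty (i : ℕ) : (i : WithTop ℕ∞) ≤ ∞ := by exact_mod_cast le_top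

theorem add (hu : DerivBound l k u A) (hv : DerivBound l k v B) :
    DerivBound l k (fun x => u x + v x) (A + B) := by
  refine ⟨hu.1.add hv.1, fun i h1 h2 x => ?_⟩
  rw [iteratedDeriv_fun_add ((hu.1.of_le (natCast_le_infty i)).contDiffAt)
    ((hv.1.of_le (natCast_le_infty i)).contDiffAt)]
  exact (abs_add_le _ _).trans (add_le_add (hu.2 i h1 h2 x) (hv.2 i h1 h2 x))

theorem neg (hu : DerivBound l k u A) : DerivBound l k (fun x => -u x) A := by
  refine ⟨hu.1.neg, fun i h1 h2 x => ?_⟩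
  rw [iteratedDeriv_fun_neg, abs_neg]
  exact hu.2 i h1 h2 x

theorem const (k : ℕ) (c : ℝ) : DerivBound 0 k (fun _ => c) |c| := by
  refine ⟨contDiff_const, fun i _ _ x => ?_⟩
  rw [iteratedDeriv_const]
  split_ifs <;> simp

theorem mul (hu : DerivBound 0 k u A) (hv : DerivBound 0 k v B) :
    DerivBound 0 k (fun x => u x * v x) (2 ^ k * (A * B)) := by
  refine ⟨hu.1.mul hv.1, fun i _ h2 x => ?_⟩
  have hA := hu.nonneg (Nat.zero_le _)
  have hB := hv.nonneg (Nat.zero_le _)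
  have key := norm_iteratedFDeriv_mul_le hu.1 hv.1 x (natCast_le_infty i)
  simp only [norm_iteratedFDeriv_eq_norm_iteratedDeriv, Real.norm_eq_abs] at key
  calc |iteratedDeriv i (fun x => u x * v x) x| ≤ _ := key
    _ ≤ ∑ j ∈ Finset.range (i + 1), (i.choose j : ℝ) * (A * B) := by
        refine Finset.sum_le_sum fun j hj => ?_
        rw [mul_assoc]
        have hj' := Finset.mem_range_succ_iff.1 hj
        exact mul_le_mul_of_nonneg_left (mul_le_mul (hu.2 j (Nat.zero_le _) (by omega) x)
          (hv.2 (i - j) (Nat.zero_le _) (by omega) x) (abs_nonneg _) hA) (by positivity)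
    _ = 2 ^ i * (A * B) := by
        rw [← Finset.sum_mul]
        congr 1
        exact_mod_cast Nat.sum_range_choose i
    _ ≤ 2 ^ k * (A * B) := by
        gcongr
        norm_num

/-- The Faà di Bruno estimate. Only derivatives of order at least one of the inner map enter, so it
applies to lifts, which are unbounded; this is the purpose of the lower index in `DerivBound`. The
condition `1 ≤ D` gives `D ≤ D ^ j`, the form in which the estimate takes its input. -/
theorem comp (hu : DerivBound 0 k u A) (hφ : DerivBound 1 k φ D) (hD : 1 ≤ D) :
    DerivBound 0 k (fun x => u (φ x)) (k.factorial * A * D ^ k) := by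
  refine ⟨hu.1.comp hφ.1, fun i _ h2 x => ?_⟩
  have hA := hu.nonneg (Nat.zero_le _)
  have key := norm_iteratedFDeriv_comp_le (n := i) (C := A) (D := D) hu.1 hφ.1
    (natCast_le_infty i) x
    (fun j hj => by
      rw [norm_iteratedFDeriv_eq_norm_iteratedDeriv]
      exact hu.2 j (Nat.zero_le _) (hj.trans h2) _)
    (fun j hj hj' => by
      rw [norm_iteratedFDeriv_eq_norm_iteratedDeriv]
      exact (hφ.2 j hj (hj'.trans h2) _).trans (le_self_pow₀ hD (by omega)))
  rw [norm_iteratedFDeriv_eq_norm_iteratedDeriv] at key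
  refine key.trans ?_
  gcongr

theorem deriv (h : DerivBound 1 (k + 1) u A) : DerivBound 0 k (deriv u) A := by
  refine ⟨h.1.deriv', fun i _ h2 x => ?_⟩
  rw [← iteratedDeriv_succ']
  exact h.2 (i + 1) (by omega) (by omega) x

theorem of_deriv (hu : ContDiff ℝ ∞ u) (h : DerivBound 0 k (_root_.deriv u) A) :
    DerivBound 1 (k + 1) u A := by
  refine ⟨hu, fun i h1 h2 x => ?_⟩
  obtain ⟨j, rfl⟩ := Nat.exists_eq_add_of_le' h1
  rw [iteratedDeriv_succ']
  exact h.2 j (Nat.zero_le _) (by omega) x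

theorem of_deriv_of_le (h : DerivBound 1 k u A) (h0 : ∀ x, |u x| ≤ A) : DerivBound 0 k u A := by
  refine ⟨h.1, fun i _ h2 x => ?_⟩
  rcases Nat.eq_zero_or_pos i with rfl | hi
  · simpa using h0 x
  · exact h.2 i hi h2 x

theorem zero_of_le (hu : ContDiff ℝ ∞ u) (h0 : ∀ x, |u x| ≤ A) : DerivBound 0 0 u A :=
  of_deriv_of_le ⟨hu, fun i h1 h2 => by omega⟩ h0

theorem one_of_id (k : ℕ) (c : ℝ) : DerivBound 1 k (fun x => x + c) 1 := by
  have : DerivBound 1 (k + 1) (fun x => x + c) 1 := by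
    refine of_deriv (by fun_prop) ?_
    have : _root_.deriv (fun x => x + c) = fun _ => (1 : ℝ) := by ext x; simp
    rw [this]
    simpa using const k 1
  exact this.mono le_rfl (Nat.le_succ k) le_rfl

/-- The first derivative bounds the increments. -/
theorem abs_sub_le (h : DerivBound 1 1 u A) (x y : ℝ) : |u x - u y| ≤ A * |x - y| := by
  have := Convex.norm_image_sub_le_of_norm_deriv_le (f := u) (s := univ) (x := y) (y := x) (C := A)
    (fun z _ => (h.1.differentiable (by simp)).differentiableAt)
    (fun z _ => by simpa using h.2 1 le_rfl le_rfl z) convex_univ (mem_univ _) (mem_univ _)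
  simpa using this

theorem contDiff_iteratedDeriv (h : DerivBound l k u A) (i : ℕ) :
    ContDiff ℝ ∞ (iteratedDeriv i u) := by
  induction i with
  | zero => simpa using h.1
  | succ i ih =>
    rw [iteratedDeriv_succ]
    exact ih.deriv'

/-- The difference of two translates of a function. -/
theorem sub_translate (h : DerivBound 1 (k + 1) u A) (s : ℝ) :
    DerivBound 0 k (fun x => u (x + s) - u x) (A * |s|) := by
  have hs : ContDiff ℝ ∞ fun x => u (x + s) := h.1.comp (contDiff_id.add contDiff_const)
  refine ⟨hs.sub h.1, fun i _ h2 x => ?_⟩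
  rw [iteratedDeriv_fun_sub ((hs.of_le (natCast_le_infty i)).contDiffAt)
    ((h.1.of_le (natCast_le_infty i)).contDiffAt), iteratedDeriv_comp_add_const]
  have h1 : DerivBound 1 1 (iteratedDeriv i u) A := by
    refine ⟨h.contDiff_iteratedDeriv i, fun j hj hj' y => ?_⟩
    obtain rfl : j = 1 := le_antisymm hj' hj
    rw [_root_.iteratedDeriv_one, ← iteratedDeriv_succ]
    exact h.2 (i + 1) (by omega) (by omega) y
  simpa using h1.abs_sub_le (x + s) x

/-- Polynomial bounds on the reciprocal of a function bounded away from zero. -/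
theorem exists_inv (k : ℕ) : ∃ (C : ℝ) (N : ℕ), 1 ≤ C ∧ ∀ (v : ℝ → ℝ) (A : ℝ), 1 ≤ A →
    (∀ x, 1 / A ≤ v x) → DerivBound 0 k v A → DerivBound 0 k (fun x => (v x)⁻¹) (C * A ^ N) := by
  induction k with
  | zero =>
    refine ⟨1, 1, le_rfl, fun v A hA hv h => ?_⟩
    have hpos : ∀ x, 0 < v x := fun x => lt_of_lt_of_le (by positivity) (hv x)
    refine zero_of_le (h.1.inv fun x => (hpos x).ne') fun x => ?_
    rw [abs_of_pos (inv_pos.2 (hpos x)), one_mul, pow_one]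
    simpa using inv_anti₀ (by positivity) (hv x)
  | succ k ih =>
    obtain ⟨C, N, hC, H⟩ := ih
    refine ⟨2 ^ k * (2 ^ k * (C * C)) , N + N + 1, ?_, fun v A hA hv h => ?_⟩
    · have h2 : (1 : ℝ) ≤ 2 ^ k := one_le_pow₀ (by norm_num)
      nlinarith [one_le_mul_of_one_le_of_one_le hC hC,
        one_le_mul_of_one_le_of_one_le h2 (one_le_mul_of_one_le_of_one_le hC hC)]
    have hpos : ∀ x, 0 < v x := fun x => lt_of_lt_of_le (by positivity) (hv x)
    have hk := H v A hA hv (h.mono le_rfl (Nat.le_succ k) le_rfl)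
    -- The identity `(1/v)' = -v' / v²` involves `1/v` only to order `k`. The product rule, applied
    -- twice, then yields the exponent `N + N + 1` and the two factors `2 ^ k`.
    have hd : _root_.deriv (fun x => (v x)⁻¹) =
        fun x => -(_root_.deriv v x * ((v x)⁻¹ * (v x)⁻¹)) := by
      ext x
      rw [deriv_fun_inv'' ((h.1.differentiable (by simp)).differentiableAt) (hpos x).ne']
      field_simp
    have hb := ((h.mono (Nat.zero_le 1) le_rfl le_rfl).deriv.mul (hk.mul hk)).neg
    rw [← hd] at hb
    have hAN : A ≤ A ^ (N + N + 1) := le_self_pow₀ hA (by omega)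
    have h2 : (1 : ℝ) ≤ 2 ^ k * (2 ^ k * (C * C)) := by
      have h2 : (1 : ℝ) ≤ 2 ^ k := one_le_pow₀ (by norm_num)
      exact one_le_mul_of_one_le_of_one_le h2
        (one_le_mul_of_one_le_of_one_le h2 (one_le_mul_of_one_le_of_one_le hC hC))
    refine of_deriv_of_le (of_deriv (h.1.inv fun x => (hpos x).ne')
      (hb.mono le_rfl le_rfl (le_of_eq ?_))) fun x => ?_
    · ring
    · rw [abs_of_pos (inv_pos.2 (hpos x))]
      calc (v x)⁻¹ ≤ A := by simpa using inv_anti₀ (by positivity) (hv x)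
        _ ≤ A ^ (N + N + 1) := hAN
        _ ≤ _ := le_mul_of_one_le_left (by positivity) h2

/-- Polynomial bounds on the derivatives of an inverse function. -/
theorem exists_inverse (k : ℕ) : ∃ (C : ℝ) (N : ℕ), 1 ≤ C ∧ ∀ (φ h : ℝ → ℝ) (A : ℝ), 1 ≤ A →
    (∀ x, 1 / A ≤ _root_.deriv φ x) → (∀ x, φ (h x) = x) → ContDiff ℝ ∞ h →
    DerivBound 1 k φ A → DerivBound 1 k h (C * A ^ N) := by
  induction k with
  | zero => exact ⟨1, 0, le_rfl, fun φ h A _ _ _ hh _ => ⟨hh, fun i h1 h2 => by omega⟩⟩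
  | succ k ih =>
    obtain ⟨C, N, hC, H⟩ := ih
    obtain ⟨C', N', hC', H'⟩ := exists_inv k
    refine ⟨k.factorial * C' * C ^ k, N' + N * k, ?_, fun φ h A hA hφ hh hs hb => ?_⟩
    · have : (1 : ℝ) ≤ k.factorial := by exact_mod_cast Nat.one_le_iff_ne_zero.2 k.factorial_ne_zero
      exact one_le_mul_of_one_le_of_one_le (one_le_mul_of_one_le_of_one_le this hC')
        (one_le_pow₀ hC)
    have hk := H φ h A hA hφ hh hs (hb.mono le_rfl (Nat.le_succ k) le_rfl)
    have hr := H' _ A hA hφ hb.deriv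
    -- In `h' = 1 / φ'(h)` the right side needs `h` only to order `k`, so the induction gains one
    -- derivative.
    have hd : _root_.deriv h = fun x => (_root_.deriv φ (h x))⁻¹ := by
      ext x
      have h1 := (hb.1.differentiable (by simp) (h x)).hasDerivAt.comp x
        (hs.differentiable (by simp) x).hasDerivAt
      have h2 : φ ∘ h = id := funext hh
      rw [h2] at h1
      exact eq_inv_of_mul_eq_one_right (h1.unique (hasDerivAt_id x))
    refine of_deriv hs ?_
    rw [hd]
    refine (hr.comp hk (one_le_mul_of_one_le_of_one_le hC (one_le_pow₀ hA))).mono le_rfl le_rfl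
      (le_of_eq ?_)
    ring

/-- Composition with a map close to the identity. -/
theorem exists_perturb (k : ℕ) : ∀ F : ℝ → ℝ, (∀ m, ∃ A, DerivBound 1 m F A) →
    ∃ C : ℝ, 0 ≤ C ∧ ∀ (w : ℝ → ℝ) (η : ℝ), η ≤ 1 → DerivBound 0 k w η →
      DerivBound 0 k (fun x => F (x + w x) - F x) (C * η) := by
  induction k with
  | zero =>
    intro F hF
    obtain ⟨A, hA⟩ := hF 1
    refine ⟨A, hA.nonneg le_rfl, fun w η _ hw => ?_⟩
    refine zero_of_le ((hA.1.comp (contDiff_id.add hw.1)).sub hA.1) fun x => ?_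
    refine (hA.abs_sub_le _ _).trans (mul_le_mul_of_nonneg_left ?_ (hA.nonneg le_rfl))
    simpa using hw.2 0 le_rfl le_rfl x
  | succ k ih =>
    intro F hF
    obtain ⟨A, hA⟩ := hF (k + 1)
    obtain ⟨A0, hA0⟩ := hF 1
    have hA' := hA0.nonneg le_rfl
    have hA1 := hA.nonneg (by omega)
    have hF' : ∀ m, ∃ A, DerivBound 1 m (_root_.deriv F) A := fun m => by
      obtain ⟨B, hB⟩ := hF (m + 1)
      exact ⟨B, hB.deriv.mono zero_le_one le_rfl le_rfl⟩
    -- The derivative of `F(x + w) - F(x)` is the same expression for `F'` plus `F'(x + w) w'`. The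
    -- first term is covered by the induction hypothesis, which therefore quantifies over `F`; the
    -- second carries a factor `η` from `w'`.
    obtain ⟨C, hC, H⟩ := ih _ hF'
    set E : ℝ := 2 ^ k * ((k.factorial * A * 2 ^ k)) with hE
    have hE0 : 0 ≤ E := by positivity
    refine ⟨A0 + (C + E), by positivity, fun w η hη hw => ?_⟩
    have hη0 : 0 ≤ η := hw.nonneg (by omega)
    have hs : ContDiff ℝ ∞ fun x => F (x + w x) - F x :=
      (hA.1.comp (contDiff_id.add hw.1)).sub hA.1
    have hid : DerivBound 1 k (fun x => x + w x) 2 := by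
      have h1 := (one_of_id k 0).add (hw.mono (Nat.zero_le 1) (Nat.le_succ k) hη)
      simp only [add_zero] at h1
      exact h1.mono le_rfl le_rfl (by norm_num)
    have h1 := H w η hη (hw.mono le_rfl (Nat.le_succ k) le_rfl)
    have h2 := (hA.deriv.comp hid (by norm_num)).mul
      (hw.mono (Nat.zero_le 1) le_rfl le_rfl).deriv
    have h3 := h1.add h2
    have hd : _root_.deriv (fun x => F (x + w x) - F x) = fun x =>
        (_root_.deriv F (x + w x) - _root_.deriv F x) +
          _root_.deriv F (x + w x) * _root_.deriv w x := by
      ext x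
      have hFx := (hA.1.differentiable (by simp) (x + w x)).hasDerivAt
      have hwx := (hw.1.differentiable (by simp) x).hasDerivAt
      have := (hFx.comp x ((hasDerivAt_id x).add hwx)).sub
        (hA.1.differentiable (by simp) x).hasDerivAt
      have h4 := this.deriv
      simp only [Pi.sub_def, Function.comp_def, id, Pi.add_apply] at h4
      rw [h4]
      ring
    rw [← hd] at h3
    refine of_deriv_of_le (of_deriv hs (h3.mono le_rfl le_rfl ?_)) fun x => ?_
    · rw [hE]
      have : 0 ≤ A0 * η := by positivity
      linarith
    · refine (hA0.abs_sub_le _ _).trans ?_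
      have h5 : |x + w x - x| ≤ η := by simpa using hw.2 0 le_rfl (by omega) x
      have h6 := mul_le_mul_of_nonneg_left h5 hA'
      have : 0 ≤ (C + E) * η := by positivity
      linarith

end DerivBound

/-! ### A degree one map which is constant on half of the circle -/

/-- The map is the normalized primitive of `exp(-1 / sin(2πt))`, extended by zero where the sine is
not positive. This density is smooth and `1`-periodic, and vanishes on `[1/2, 1]`. -/
theorem exists_flat_map : ∃ ψ : ℝ → ℝ, ContDiff ℝ ∞ ψ ∧ Monotone ψ ∧ (∀ x, ψ (x + 1) = ψ x + 1) ∧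
    ψ 0 = 0 ∧ ψ (1 / 2) = ψ 1 := by
  set g : ℝ → ℝ := fun t => expNegInvGlue (Real.sin (2 * Real.pi * t)) with hg
  have hgs : ContDiff ℝ ∞ g :=
    expNegInvGlue.contDiff.comp (Real.contDiff_sin.comp (contDiff_const.mul contDiff_id))
  have hgc : Continuous g := hgs.continuous
  have hg0 : ∀ t, 0 ≤ g t := fun t => expNegInvGlue.nonneg _
  have hint : ∀ a b, IntervalIntegrable g MeasureTheory.volume a b :=
    fun a b => hgc.intervalIntegrable a b
  have hper : Function.Periodic g 1 := by
    intro t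
    simp only [hg]
    rw [mul_add, mul_one, Real.sin_add_two_pi]
  set c : ℝ := ∫ t in (0 : ℝ)..1, g t with hc
  have hpos : 0 < c := by
    refine intervalIntegral.integral_pos one_pos hgc.continuousOn (fun t _ => hg0 t)
      ⟨1 / 4, by norm_num, ?_⟩
    refine expNegInvGlue.pos_of_pos ?_
    rw [show 2 * Real.pi * (1 / 4) = Real.pi / 2 by ring, Real.sin_pi_div_two]
    exact one_pos
  have hd : ∀ x, HasDerivAt (fun x => (∫ t in (0 : ℝ)..x, g t) / c) (g x / c) x := fun x =>
    (intervalIntegral.integral_hasDerivAt_right (hint 0 x)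
      (hgc.stronglyMeasurableAtFilter _ _) hgc.continuousAt).div_const c
  refine ⟨fun x => (∫ t in (0 : ℝ)..x, g t) / c, ?_, ?_, ?_, ?_, ?_⟩
  · rw [contDiff_infty_iff_deriv]
    refine ⟨fun x => (hd x).differentiableAt, ?_⟩
    rw [funext fun x => (hd x).deriv]
    exact hgs.div_const c
  · refine monotone_of_deriv_nonneg (fun x => (hd x).differentiableAt) fun x => ?_
    rw [(hd x).deriv]
    exact div_nonneg (hg0 x) hpos.le
  · intro x
    have h1 : ∫ t in (0 : ℝ)..(x + 1), g t = (∫ t in (0 : ℝ)..x, g t) + c := by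
      rw [← intervalIntegral.integral_add_adjacent_intervals (hint 0 x) (hint x (x + 1)),
        hper.intervalIntegral_add_eq x 0, zero_add]
    simp only [h1]
    field_simp
  · simp
  · simp only
    congr 1
    have h2 : ∫ t in (1 / 2 : ℝ)..1, g t = 0 := by
      rw [intervalIntegral.integral_congr (g := fun _ => (0 : ℝ))]
      · simp
      · intro t ht
        rw [uIcc_of_le (by norm_num)] at ht
        refine expNegInvGlue.zero_of_nonpos ?_
        have h3 : Real.sin (2 * Real.pi * t) = - Real.sin (2 * Real.pi * t - Real.pi) := by
          rw [Real.sin_sub_pi, neg_neg]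
        rw [h3, neg_nonpos]
        have hp := Real.pi_pos
        exact Real.sin_nonneg_of_nonneg_of_le_pi (by nlinarith [ht.1]) (by nlinarith [ht.2])
    rw [← intervalIntegral.integral_add_adjacent_intervals (hint 0 (1 / 2)) (hint (1 / 2) 1), h2,
      add_zero]

/-- A smooth monotone map of degree one which is constant on `[1/2, 1]`. -/
noncomputable def flat : ℝ → ℝ := exists_flat_map.choose

theorem contDiff_flat : ContDiff ℝ ∞ flat := exists_flat_map.choose_spec.1

theorem monotone_flat : Monotone flat := exists_flat_map.choose_spec.2.1

theorem flat_add_one (x : ℝ) : flat (x + 1) = flat x + 1 := exists_flat_map.choose_spec.2.2.1 x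

theorem flat_zero : flat 0 = 0 := exists_flat_map.choose_spec.2.2.2.1

theorem flat_half : flat (1 / 2) = flat 1 := exists_flat_map.choose_spec.2.2.2.2

/-- `flat` as a lift of a circle map. -/
noncomputable def flatLift : CircleDeg1Lift := ⟨⟨flat, monotone_flat⟩, flat_add_one⟩

theorem flat_add_intCast (x : ℝ) (n : ℤ) : flat (x + n) = flat x + n :=
  flatLift.map_add_int x n

theorem flat_add_natCast (x : ℝ) (n : ℕ) : flat (x + n) = flat x + n :=
  flatLift.map_add_nat x n

/-- A monotone map that fixes the integers preserves every interval between consecutive integers. -/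
theorem abs_flat_sub_le (x : ℝ) : |flat x - x| ≤ 1 := by
  have h : ∀ n : ℤ, flat n = n := fun n => by
    have := flat_add_intCast 0 n
    rwa [zero_add, flat_zero, zero_add] at this
  have h1 := monotone_flat (Int.floor_le x)
  have h2 := monotone_flat (Int.lt_floor_add_one x).le
  have h3 := h (⌊x⌋ + 1)
  push_cast at h3
  rw [h] at h1
  rw [h3] at h2
  have h4 := Int.floor_le x
  have h5 := (Int.lt_floor_add_one x).le
  rw [abs_le]
  constructor <;> linarith

/-! ### Smooth lifts -/

/-- An increasing homeomorphism of the line of degree one, as a unit. -/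
theorem exists_unit_of_strictMono {F : ℝ → ℝ} (hF : StrictMono F) (hc : Continuous F)
    (h1 : ∀ x, F (x + 1) = F x + 1) : ∃ u : CircleDeg1Liftˣ, ∀ x, u x = F x := by
  let G : CircleDeg1Lift := ⟨⟨F, hF.monotone⟩, h1⟩
  have hG : IsUnit G := CircleDeg1Lift.isUnit_iff_bijective.2
    ⟨hF.injective, Continuous.surjective hc G.tendsto_atTop G.tendsto_atBot⟩
  exact ⟨hG.unit, fun x => rfl⟩

/-- The unit is a smooth diffeomorphism of the line. -/
def SmoothUnit (u : CircleDeg1Liftˣ) : Prop := ContDiff ℝ ∞ u ∧ ContDiff ℝ ∞ (u⁻¹ : CircleDeg1Liftˣ)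

namespace SmoothUnit

variable {u v : CircleDeg1Liftˣ}

theorem one : SmoothUnit 1 := ⟨contDiff_id, contDiff_id⟩

theorem mul (hu : SmoothUnit u) (hv : SmoothUnit v) : SmoothUnit (u * v) := by
  refine ⟨hu.1.comp hv.1, ?_⟩
  rw [mul_inv_rev]
  exact hv.2.comp hu.2

theorem inv (hu : SmoothUnit u) : SmoothUnit u⁻¹ := by
  refine ⟨hu.2, ?_⟩
  rw [inv_inv]
  exact hu.1

theorem of_deriv_pos (hu : ContDiff ℝ ∞ u) (h : ∀ x, 0 < deriv u x) : SmoothUnit u :=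
  ⟨hu, (CircleDeg1Lift.toOrderIso u).toHomeomorph.contDiff_symm_deriv (fun x => (h x).ne')
    (fun x => (hu.differentiable (by simp) x).hasDerivAt) hu⟩

theorem exists_derivBound (hu : SmoothUnit u) (k : ℕ) : ∃ A, 1 ≤ A ∧ DerivBound 1 k u A := by
  induction k with
  | zero => exact ⟨1, le_rfl, hu.1, fun i h1 h2 => by omega⟩
  | succ k ih =>
    obtain ⟨A, hA1, hA⟩ := ih
    obtain ⟨C, hC⟩ := exists_bound_iteratedDeriv (u : CircleDeg1Lift) k.succ_ne_zero
      (hu.1.of_le (DerivBound.natCast_le_infty _))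
    refine ⟨max A C, hA1.trans (le_max_left _ _), hu.1, fun i h1 h2 x => ?_⟩
    rcases Nat.of_le_succ h2 with h | rfl
    · exact (hA.2 i h1 h x).trans (le_max_left _ _)
    · exact (hC x).trans (le_max_right _ _)

end SmoothUnit

/-- Translation by `t`. -/
noncomputable abbrev transl (t : ℝ) : CircleDeg1Liftˣ :=
  CircleDeg1Lift.translate (Multiplicative.ofAdd t)

theorem smoothUnit_transl (t : ℝ) : SmoothUnit (transl t) :=
  ⟨contDiff_const.add contDiff_id, contDiff_const.add contDiff_id⟩

/-! ### The building blocks -/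

/-- A diffeomorphism which contracts each interval `[(j + 1/2)/q, (j + 1)/q]` by the
factor `e`. -/
noncomputable def squeezeFun (e : ℝ) (q : ℕ) (x : ℝ) : ℝ := e * x + (1 - e) * (flat (q * x) / q)

theorem contDiff_squeezeFun (e : ℝ) (q : ℕ) : ContDiff ℝ ∞ (squeezeFun e q) := by
  have := contDiff_flat.comp (contDiff_const (c := (q : ℝ)).mul contDiff_id)
  exact (contDiff_const.mul contDiff_id).add (contDiff_const.mul (this.div_const _))

/-- The `+ 0` keeps the inner map in the affine form used in `exists_derivBound_squeeze`. -/
theorem deriv_squeezeFun (e : ℝ) {q : ℕ} (hq : 0 < q) :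
    deriv (squeezeFun e q) = fun x => e + (1 - e) * deriv flat (q * x + 0) := by
  have hq' : (0 : ℝ) < q := by exact_mod_cast hq
  ext x
  have h1 := (contDiff_flat.differentiable (by simp) (q * x)).hasDerivAt.comp x
    ((hasDerivAt_id x).const_mul (q : ℝ))
  have h2 := ((hasDerivAt_id x).const_mul e).add ((h1.div_const (q : ℝ)).const_mul (1 - e))
  refine (HasDerivAt.deriv (f := squeezeFun e q) (h2.congr_deriv ?_))
  field_simp
  simp

theorem le_deriv_squeezeFun {e : ℝ} (he1 : e ≤ 1) {q : ℕ} (hq : 0 < q) (x : ℝ) :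
    e ≤ deriv (squeezeFun e q) x := by
  rw [deriv_squeezeFun e hq]
  have := mul_nonneg (sub_nonneg.2 he1) (monotone_flat.deriv_nonneg (x := q * x + 0))
  simpa using this

theorem squeezeFun_add_one (e : ℝ) {q : ℕ} (hq : 0 < q) (x : ℝ) :
    squeezeFun e q (x + 1) = squeezeFun e q x + 1 := by
  have hq' : (0 : ℝ) < q := by exact_mod_cast hq
  unfold squeezeFun
  rw [mul_add, mul_one, mul_add, mul_one, flat_add_natCast]
  field_simp
  ring

/-- Commutation with the rotation by `p / q` is what makes conjugation by a building block harmless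
when `α` is close to `p / q`. -/
theorem squeezeFun_add_div (e : ℝ) {q : ℕ} (hq : 0 < q) (x : ℝ) (p : ℤ) :
    squeezeFun e q (x + p / q) = squeezeFun e q x + p / q := by
  have hq' : (0 : ℝ) < q := by exact_mod_cast hq
  unfold squeezeFun
  rw [show (q : ℝ) * (x + p / q) = q * x + p by field_simp, flat_add_intCast]
  field_simp
  ring

theorem exists_squeeze {e : ℝ} (he : 0 < e) (he1 : e ≤ 1) {q : ℕ} (hq : 0 < q) :
    ∃ u : CircleDeg1Liftˣ, ∀ x, u x = squeezeFun e q x :=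
  exists_unit_of_strictMono
    (strictMono_of_deriv_pos fun x => he.trans_le (le_deriv_squeezeFun he1 hq x))
    (contDiff_squeezeFun e q).continuous (squeezeFun_add_one e hq)

/-- The contraction factor of the building blocks. -/
noncomputable def factor (n q : ℕ) : ℝ := ((q : ℝ) ^ n)⁻¹

theorem factor_pos (n : ℕ) {q : ℕ} (hq : 0 < q) : 0 < factor n q := by
  unfold factor
  positivity

theorem factor_le_one (n : ℕ) {q : ℕ} (hq : 0 < q) : factor n q ≤ 1 :=
  inv_le_one_of_one_le₀ (one_le_pow₀ (by exact_mod_cast hq))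

/-- The building blocks, as units. -/
noncomputable def squeeze (n q : ℕ) : CircleDeg1Liftˣ :=
  -- The value at `q = 0` is irrelevant; the parameters of a `GoodSeq` are positive.
  if h : 0 < q then (exists_squeeze (factor_pos n h) (factor_le_one n h) h).choose else 1

theorem squeeze_apply (n : ℕ) {q : ℕ} (hq : 0 < q) (x : ℝ) :
    squeeze n q x = squeezeFun (factor n q) q x := by
  rw [squeeze, dif_pos hq]
  exact (exists_squeeze (factor_pos n hq) (factor_le_one n hq) hq).choose_spec x

theorem coe_squeeze (n : ℕ) {q : ℕ} (hq : 0 < q) :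
    ⇑(squeeze n q : CircleDeg1Lift) = squeezeFun (factor n q) q :=
  funext (squeeze_apply n hq)

theorem smoothUnit_squeeze (n q : ℕ) : SmoothUnit (squeeze n q) := by
  rcases Nat.eq_zero_or_pos q with rfl | hq
  · rw [squeeze, dif_neg (lt_irrefl 0)]
    exact SmoothUnit.one
  · refine SmoothUnit.of_deriv_pos ?_ fun x => ?_
    · rw [coe_squeeze n hq]
      exact contDiff_squeezeFun _ _
    · rw [coe_squeeze n hq]
      exact (factor_pos n hq).trans_le (le_deriv_squeezeFun (factor_le_one n hq) hq x)

theorem abs_squeeze_sub_le (n : ℕ) {q : ℕ} (hq : 0 < q) (x : ℝ) :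
    |squeeze n q x - x| ≤ 1 / q := by
  have hq' : (0 : ℝ) < q := by exact_mod_cast hq
  rw [squeeze_apply n hq, squeezeFun]
  have h1 := abs_flat_sub_le (q * x)
  have h2 := factor_pos n hq
  have h3 := factor_le_one n hq
  set e := factor n q
  have h4 : e * x + (1 - e) * (flat (q * x) / q) - x = (1 - e) * ((flat (q * x) - q * x) / q) := by
    field_simp
    ring
  rw [h4, abs_mul, abs_div, abs_of_pos hq', abs_of_nonneg (sub_nonneg.2 h3)]
  calc (1 - e) * (|flat (q * x) - q * x| / q) ≤ 1 * (1 / q) := by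
        gcongr
        linarith
    _ = 1 / q := one_mul _

theorem abs_squeeze_inv_sub_le (n : ℕ) {q : ℕ} (hq : 0 < q) (x : ℝ) :
    |(squeeze n q)⁻¹ x - x| ≤ 1 / q := by
  have := abs_squeeze_sub_le n hq ((squeeze n q)⁻¹ x)
  rwa [CircleDeg1Lift.units_apply_inv_apply, abs_sub_comm] at this

theorem squeeze_add_div (n : ℕ) {q : ℕ} (hq : 0 < q) (x : ℝ) (p : ℤ) :
    squeeze n q (x + p / q) = squeeze n q x + p / q := by
  rw [squeeze_apply n hq, squeeze_apply n hq, squeezeFun_add_div _ hq]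

theorem squeeze_inv_add_div (n : ℕ) {q : ℕ} (hq : 0 < q) (x : ℝ) (p : ℤ) :
    (squeeze n q)⁻¹ (x + p / q) = (squeeze n q)⁻¹ x + p / q := by
  have := squeeze_add_div n hq ((squeeze n q)⁻¹ x) p
  rw [CircleDeg1Lift.units_apply_inv_apply] at this
  rw [← this, CircleDeg1Lift.units_inv_apply_apply]

/-- The building block contracts an interval of length `1 / (2 q)`. -/
theorem squeeze_contracts (n : ℕ) {q : ℕ} (hq : 0 < q) :
    squeeze n q (1 / q) - squeeze n q (1 / (2 * q)) = factor n q / (2 * q) := by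
  have hq' : (0 : ℝ) < q := by exact_mod_cast hq
  rw [squeeze_apply n hq, squeeze_apply n hq, squeezeFun, squeezeFun]
  rw [show (q : ℝ) * (1 / q) = 1 by field_simp, show (q : ℝ) * (1 / (2 * q)) = 1 / 2 by field_simp,
    flat_half]
  field_simp
  ring

theorem exists_derivBound_flat (k : ℕ) : ∃ A, 1 ≤ A ∧ DerivBound 1 k flat A := by
  induction k with
  | zero => exact ⟨1, le_rfl, contDiff_flat, fun i h1 h2 => by omega⟩
  | succ k ih =>
    obtain ⟨A, hA1, hA⟩ := ih
    obtain ⟨C, hC⟩ := exists_bound_iteratedDeriv flatLift k.succ_ne_zero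
      (contDiff_flat.of_le (DerivBound.natCast_le_infty _))
    refine ⟨max A C, hA1.trans (le_max_left _ _), contDiff_flat, fun i h1 h2 x => ?_⟩
    rcases Nat.of_le_succ h2 with h | rfl
    · exact (hA.2 i h1 h x).trans (le_max_left _ _)
    · exact (hC x).trans (le_max_right _ _)

/-- Each differentiation of `flat (q x)` costs one factor `q`. The point is the order of the
quantifiers: the exponent is fixed before `q`, so a Liouville approximation can beat it. -/
theorem exists_derivBound_squeeze (n k : ℕ) : ∃ (C : ℝ) (N : ℕ), 1 ≤ C ∧ ∀ q : ℕ, 0 < q →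
    DerivBound 1 k (squeeze n q) (C * (q : ℝ) ^ N) := by
  obtain ⟨A, hA1, hA⟩ := exists_derivBound_flat (k + 1)
  refine ⟨1 + k.factorial * A, k, ?_, fun q hq => ?_⟩
  · have : 0 ≤ k.factorial * A := by positivity
    linarith
  have hq' : (1 : ℝ) ≤ q := by exact_mod_cast hq
  have he := factor_pos n hq
  have he1 := factor_le_one n hq
  rw [coe_squeeze n hq]
  set e := factor n q
  have hlin : DerivBound 1 k (fun x : ℝ => q * x + 0) q := by
    have : DerivBound 1 (k + 1) (fun x : ℝ => q * x + 0) q := by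
      refine DerivBound.of_deriv (by fun_prop) ?_
      have : deriv (fun x : ℝ => q * x + 0) = fun _ => (q : ℝ) := by
        ext x
        simp
      rw [this]
      simpa using DerivBound.const k (q : ℝ)
    exact this.mono le_rfl (Nat.le_succ k) le_rfl
  have h1 := hA.deriv.comp hlin hq'
  have h2 : DerivBound 0 k (fun x => e + (1 - e) * deriv flat (q * x + 0))
      ((1 + k.factorial * A) * (q : ℝ) ^ k) := by
    refine ⟨contDiff_const.add (contDiff_const.mul h1.1), fun i _ h2 x => ?_⟩
    rw [iteratedDeriv_fun_add contDiff_const.contDiffAt (contDiff_const.mul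
      (h1.1.of_le (DerivBound.natCast_le_infty i))).contDiffAt, iteratedDeriv_const_mul_field]
    have h3 := (DerivBound.const k e).2 i (Nat.zero_le _) h2 x
    have h4 := h1.2 i (Nat.zero_le _) h2 x
    refine (abs_add_le _ _).trans ?_
    rw [abs_mul, add_mul]
    refine add_le_add (h3.trans ?_) ?_
    · rw [abs_of_pos he, one_mul]
      exact he1.trans (one_le_pow₀ hq')
    · rw [abs_of_nonneg (sub_nonneg.2 he1)]
      refine (mul_le_of_le_one_left (abs_nonneg _) (by linarith)).trans h4
  rw [← deriv_squeezeFun e hq] at h2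
  exact (DerivBound.of_deriv (contDiff_squeezeFun e q) h2).mono le_rfl (Nat.le_succ k) le_rfl

/-- The slope of the block is at least `q ^ (-n)`, whose reciprocal is again a power of `q`. Hence
one quantity `C * q ^ (N + n)` bounds both the derivatives and the reciprocal of the slope, as
`exists_inverse` requires. -/
theorem exists_derivBound_squeeze_inv (n k : ℕ) : ∃ (C : ℝ) (N : ℕ), 1 ≤ C ∧ ∀ q : ℕ, 0 < q →
    DerivBound 1 k ((squeeze n q)⁻¹ : CircleDeg1Liftˣ) (C * (q : ℝ) ^ N) := by
  obtain ⟨C, N, hC, H⟩ := exists_derivBound_squeeze n k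
  obtain ⟨C', N', hC', H'⟩ := DerivBound.exists_inverse k
  refine ⟨C' * C ^ N', (N + n) * N', one_le_mul_of_one_le_of_one_le hC' (one_le_pow₀ hC),
    fun q hq => ?_⟩
  have hq' : (1 : ℝ) ≤ q := by exact_mod_cast hq
  have hA : (1 : ℝ) ≤ C * (q : ℝ) ^ (N + n) := one_le_mul_of_one_le_of_one_le hC (one_le_pow₀ hq')
  have hle : (q : ℝ) ^ n ≤ C * (q : ℝ) ^ (N + n) :=
    (pow_le_pow_right₀ hq' (by omega)).trans (le_mul_of_one_le_left (by positivity) hC)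
  have := H' _ _ _ hA (fun x => ?_) (CircleDeg1Lift.units_apply_inv_apply (squeeze n q))
    (smoothUnit_squeeze n q).2 ((H q hq).mono le_rfl le_rfl
      (mul_le_mul_of_nonneg_left (pow_le_pow_right₀ hq' (Nat.le_add_right N n)) (by linarith)))
  · refine this.mono le_rfl le_rfl (le_of_eq ?_)
    rw [mul_pow, ← pow_mul, mul_assoc]
  · rw [coe_squeeze n hq]
    refine le_trans ?_ (le_deriv_squeezeFun (factor_le_one n hq) hq x)
    rw [factor, ← one_div]
    exact one_div_le_one_div_of_le (by positivity) hle

/-! ### One step of the construction -/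

/-- Conjugating the translation by a further building block is a small change in `C^k`, as
soon as the translation number is well approximated by fractions of denominator `q`. -/
theorem exists_derivBound_conj_sub (n k : ℕ) {H : CircleDeg1Liftˣ} (hH : SmoothUnit H) (α : ℝ) :
    ∃ (C : ℝ) (N : ℕ), ∀ q : ℕ, 0 < q → ∀ p : ℤ, |α - p / q| * (C * (q : ℝ) ^ N) ≤ 1 →
      DerivBound 0 k (fun x => (H * (squeeze n q)⁻¹ * transl α * (H * (squeeze n q)⁻¹)⁻¹) x -
        (H * transl α * H⁻¹) x) (|α - p / q| * (C * (q : ℝ) ^ N)) := by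
  obtain ⟨C₁, N₁, hC₁, H₁⟩ := exists_derivBound_squeeze_inv n (k + 1)
  obtain ⟨C₂, N₂, hC₂, H₂⟩ := exists_derivBound_squeeze n k
  obtain ⟨C₃, hC₃, H₃⟩ := DerivBound.exists_perturb k ((H * transl α : CircleDeg1Liftˣ))
    fun m => by
      obtain ⟨A, -, hA⟩ := (hH.mul (smoothUnit_transl α)).exists_derivBound m
      exact ⟨A, hA⟩
  obtain ⟨A, hA1, hA⟩ := hH.inv.exists_derivBound k
  set a : ℝ := k.factorial * C₁ * C₂ ^ k + 1 with ha
  set b : ℝ := k.factorial * C₃ * A ^ k with hb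
  have hb0 : 0 ≤ b := by positivity
  have ha0 : 0 ≤ a := by positivity
  -- With `δ = α - p/q` and `S` the block, `S⁻¹(S y + α) = α + y + w(y)` for `w(y) = S⁻¹(S y + δ) -
  -- y - δ`, by commutation with `p/q`. The constant `a` bounds `w` by `η`, its summand `1`
  -- accounting for `-δ`; `b` bounds the effect of `w` after composition with `H` and `H⁻¹`. The
  -- extra `1` in `b + 1` makes the smallness hypothesis imply `η ≤ 1`.
  refine ⟨(b + 1) * a, N₁ + N₂ * k, fun q hq p hsmall => ?_⟩
  have hq' : (1 : ℝ) ≤ q := by exact_mod_cast hq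
  set δ := α - p / q with hδ
  set Q : ℝ := (q : ℝ) ^ (N₁ + N₂ * k) with hQ
  have hQ1 : 1 ≤ Q := one_le_pow₀ hq'
  set η : ℝ := |δ| * (a * Q) with hη
  have hη0 : 0 ≤ η := by positivity
  have hle : |δ| * ((b + 1) * a * Q) = b * η + η := by rw [hη]; ring
  rw [hle] at hsmall ⊢
  have hη1 : η ≤ 1 := by nlinarith [mul_nonneg hb0 hη0]
  have h1 := ((H₁ q hq).sub_translate δ).comp (H₂ q hq)
    (one_le_mul_of_one_le_of_one_le hC₂ (one_le_pow₀ hq'))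
  have h2 := h1.add (DerivBound.const k (-δ))
  have h3 := h2.mono (A' := η) le_rfl le_rfl (by
    rw [abs_neg, hη, ha, hQ, mul_pow, ← pow_mul, pow_add]
    have : |δ| ≤ |δ| * Q := le_mul_of_one_le_right (abs_nonneg _) hQ1
    rw [hQ, pow_add] at this
    linarith)
  have h4 := ((H₃ _ η hη1 h3).comp hA hA1).mono (A' := b * η + η) le_rfl le_rfl (by
    rw [hb]
    have : (k.factorial : ℝ) * (C₃ * η) * A ^ k = k.factorial * C₃ * A ^ k * η := by ring
    linarith)
  convert h4 using 1
  ext x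
  set y := H⁻¹ x with hy
  have e1 : (H * (squeeze n q)⁻¹ * transl α * (H * (squeeze n q)⁻¹)⁻¹) x =
      H ((squeeze n q)⁻¹ (α + squeeze n q y)) := by
    rw [mul_inv_rev, inv_inv]
    rfl
  have e2 : α + squeeze n q y = (squeeze n q y + δ) + p / q := by rw [hδ]; ring
  have e3 : ∀ z, (H * transl α : CircleDeg1Liftˣ) z = H (α + z) := fun z => rfl
  have e4 : (H * transl α * H⁻¹ : CircleDeg1Liftˣ) x = H (α + y) := rfl
  rw [e1, e2, squeeze_inv_add_div n hq, e3, e3, e4]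
  congr 2
  rw [CircleDeg1Lift.units_inv_apply_apply, hδ]
  ring

/-- The new building block may be chosen to have any sufficiently large denominator of a
sufficiently good approximation of `α`. -/
theorem exists_eventually_derivBound (n : ℕ) {H : CircleDeg1Liftˣ} (hH : SmoothUnit H) (α : ℝ) :
    ∃ N₀ : ℕ, ∀ᶠ q : ℕ in atTop, ∀ p : ℤ, |α - p / q| < 1 / (q : ℝ) ^ N₀ →
      DerivBound 0 n (fun x => (H * (squeeze n q)⁻¹ * transl α * (H * (squeeze n q)⁻¹)⁻¹) x -
        (H * transl α * H⁻¹) x) ((1 / 2) ^ n) := by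
  obtain ⟨C, N, h⟩ := exists_derivBound_conj_sub n n hH α
  -- The spare power of `q` absorbs the constant `C * 2 ^ n` once `q` is large.
  refine ⟨N + 1, ?_⟩
  filter_upwards [eventually_gt_atTop 0,
    tendsto_natCast_atTop_atTop.eventually_ge_atTop (max C 0 * 2 ^ n)] with q hq hqC p hp
  have hq' : (0 : ℝ) < q := by exact_mod_cast hq
  have key : |α - p / q| * (C * (q : ℝ) ^ N) ≤ (1 / 2) ^ n := by
    have hC0 : 0 ≤ max C 0 := le_max_right C 0
    calc |α - p / q| * (C * (q : ℝ) ^ N) ≤ |α - p / q| * (max C 0 * (q : ℝ) ^ N) := by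
          gcongr
          exact le_max_left C 0
      _ ≤ 1 / (q : ℝ) ^ (N + 1) * (max C 0 * (q : ℝ) ^ N) := by
          gcongr
      _ = max C 0 / q := by
          field_simp
          ring
      _ ≤ (1 / 2) ^ n := by
          rw [div_le_iff₀ hq', one_div, inv_pow, ← div_eq_inv_mul, le_div_iff₀ (by positivity)]
          exact hqC
  exact (h q hq p (key.trans (pow_le_one₀ (by norm_num) (by norm_num)))).mono le_rfl le_rfl key

/-- The conditions on the parameter `q` of the next building block, for the composition `H` of
the preceding ones. -/
structure GoodStep (α : ℝ) (n : ℕ) (H : CircleDeg1Liftˣ) (q : ℕ) : Prop where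
  lipschitz : ∀ x y, 2 ^ n * |H x - H y| ≤ q * |x - y|
  lipschitz_inv : ∀ x y, 2 ^ n * |H⁻¹ x - H⁻¹ y| ≤ q * |x - y|
  small : DerivBound 0 n (fun x => (H * (squeeze n q)⁻¹ * transl α * (H * (squeeze n q)⁻¹)⁻¹) x -
    (H * transl α * H⁻¹) x) ((1 / 2) ^ n)
  small_neg : DerivBound 0 n (fun x => (H * (squeeze n q)⁻¹ * transl (-α) *
    (H * (squeeze n q)⁻¹)⁻¹) x - (H * transl (-α) * H⁻¹) x) ((1 / 2) ^ n)

theorem SmoothUnit.eventually_lipschitz {H : CircleDeg1Liftˣ} (hH : SmoothUnit H) (n : ℕ) :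
    ∀ᶠ q : ℕ in atTop, ∀ x y, 2 ^ n * |H x - H y| ≤ q * |x - y| := by
  obtain ⟨A, -, hA⟩ := hH.exists_derivBound 1
  filter_upwards [tendsto_natCast_atTop_atTop.eventually_ge_atTop (2 ^ n * A)] with q hq x y
  calc 2 ^ n * |H x - H y| ≤ 2 ^ n * (A * |x - y|) := by
        gcongr
        exact hA.abs_sub_le x y
    _ = 2 ^ n * A * |x - y| := by ring
    _ ≤ q * |x - y| := by gcongr

/-- All four conditions hold for large `q` with a good enough approximation. The Lipschitz bounds
make the words converge and later bound the stretching of intervals; the estimate for `-α`, obtained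
from the fraction `-p/q`, serves the inverse diffeomorphism. -/
theorem exists_eventually_goodStep (n : ℕ) {H : CircleDeg1Liftˣ} (hH : SmoothUnit H) (α : ℝ) :
    ∃ N₀ : ℕ, ∀ᶠ q : ℕ in atTop, (∃ p : ℤ, |α - p / q| < 1 / (q : ℝ) ^ N₀) → GoodStep α n H q := by
  obtain ⟨N₁, h₁⟩ := exists_eventually_derivBound n hH α
  obtain ⟨N₂, h₂⟩ := exists_eventually_derivBound n hH (-α)
  refine ⟨max N₁ N₂, ?_⟩
  filter_upwards [h₁, h₂, hH.eventually_lipschitz n, hH.inv.eventually_lipschitz n,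
    eventually_gt_atTop 0] with q h₁ h₂ h₃ h₄ hq
  rintro ⟨p, hp⟩
  have hq' : (1 : ℝ) ≤ q := by exact_mod_cast hq
  refine ⟨h₃, h₄, h₁ p (hp.trans_le ?_), h₂ (-p) (lt_of_eq_of_lt ?_ (hp.trans_le ?_))⟩
  · exact one_div_le_one_div_of_le (by positivity) (pow_le_pow_right₀ hq' (le_max_left _ _))
  · rw [← abs_neg]
    congr 1
    push_cast
    ring
  · exact one_div_le_one_div_of_le (by positivity) (pow_le_pow_right₀ hq' (le_max_right _ _))

/-- Each `H` demands its own approximation exponent; finiteness of `S` allows the maximum to be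
taken. A Liouville number has approximations of that quality for arbitrarily large `q`. -/
theorem exists_goodStep {α : ℝ} (hα : Liouville α) (n : ℕ) {S : Set CircleDeg1Liftˣ}
    (hS : S.Finite) (hsm : ∀ H ∈ S, SmoothUnit H) (M : ℕ) :
    ∃ q : ℕ, M ≤ q ∧ ∀ H ∈ S, GoodStep α n H q := by
  have h : ∃ N₀ : ℕ, ∀ᶠ q : ℕ in atTop, (∃ p : ℤ, |α - p / q| < 1 / (q : ℝ) ^ N₀) →
      ∀ H ∈ S, GoodStep α n H q := by
    induction S, hS using Set.Finite.induction_on with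
    | empty => exact ⟨0, Eventually.of_forall fun q _ H hH => hH.elim⟩
    | @insert H S _ _ ih =>
      obtain ⟨N₁, h₁⟩ := ih fun H hH => hsm H (mem_insert_of_mem _ hH)
      obtain ⟨N₂, h₂⟩ := exists_eventually_goodStep n (hsm H (mem_insert _ _)) α
      refine ⟨max N₁ N₂, ?_⟩
      filter_upwards [h₁, h₂, eventually_gt_atTop 0] with q h₁ h₂ hq
      rintro ⟨p, hp⟩
      have hq' : (1 : ℝ) ≤ q := by exact_mod_cast hq
      rintro H' (rfl | hH')
      · exact h₂ ⟨p, hp.trans_le (one_div_le_one_div_of_le (by positivity)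
          (pow_le_pow_right₀ hq' (le_max_right _ _)))⟩
      · exact h₁ ⟨p, hp.trans_le (one_div_le_one_div_of_le (by positivity)
          (pow_le_pow_right₀ hq' (le_max_left _ _)))⟩ H' hH'
  obtain ⟨N₀, h₀⟩ := h
  obtain ⟨q, ⟨p, -, hp⟩, hq, hM⟩ := ((hα.frequently_exists_num N₀).and_eventually
    (h₀.and (eventually_ge_atTop M))).exists
  exact ⟨q, hM, hq ⟨p, hp⟩⟩

/-! ### The sequence of building blocks -/

/-- The composition of the inverse building blocks with parameters `q i`, over the `i < n`
with `a i = true`. -/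
noncomputable def word (q : ℕ → ℕ) (a : ℕ → Bool) : ℕ → CircleDeg1Liftˣ
  | 0 => 1
  | n + 1 => word q a n * bif a n then (squeeze n (q n))⁻¹ else 1

theorem smoothUnit_word (q : ℕ → ℕ) (a : ℕ → Bool) (n : ℕ) : SmoothUnit (word q a n) := by
  induction n with
  | zero => exact SmoothUnit.one
  | succ n ih =>
    refine ih.mul ?_
    cases a n
    · exact SmoothUnit.one
    · exact (smoothUnit_squeeze n (q n)).inv

theorem word_congr {q q' : ℕ → ℕ} {a a' : ℕ → Bool} {n : ℕ} (hq : ∀ i < n, q i = q' i)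
    (ha : ∀ i < n, a i = a' i) : word q a n = word q' a' n := by
  induction n with
  | zero => rfl
  | succ n ih =>
    rw [word, word, ih (fun i hi => hq i (by omega)) (fun i hi => ha i (by omega)),
      hq n n.lt_succ_self, ha n n.lt_succ_self]

/-- Finiteness lets one parameter `q n` serve all prefixes, so that the later estimates are uniform
in the binary sequence. -/
theorem finite_range_word (q : ℕ → ℕ) (n : ℕ) : (range fun a => word q a n).Finite := by
  induction n with
  | zero =>
    refine (finite_singleton (1 : CircleDeg1Liftˣ)).subset ?_
    rintro _ ⟨a, rfl⟩
    rfl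
  | succ n ih =>
    refine (ih.union (ih.image fun H => H * (squeeze n (q n))⁻¹)).subset ?_
    rintro _ ⟨a, rfl⟩
    cases h : a n
    · left
      exact ⟨a, by simp [word, h]⟩
    · right
      exact ⟨_, ⟨a, rfl⟩, by simp [word, h]⟩

/-- Dependent choice along the natural numbers. -/
theorem exists_seq_of_forall_exists {X : Type*} [Nonempty X] (G : ℕ → (ℕ → X) → X → Prop)
    (hG : ∀ n s, ∃ x, G n s x)
    (hcongr : ∀ n s t x, (∀ i < n, s i = t i) → G n s x → G n t x) :
    ∃ s : ℕ → X, ∀ n, G n s (s n) := by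
  classical
  obtain ⟨x₀⟩ := ‹Nonempty X›
  choose c hc using hG
  -- The unknown later values are filled with `x₀`; by `hcongr` they do not matter.
  let s : ℕ → X := fun n => Nat.strongRec (motive := fun _ => X)
    (fun n r => c n fun i => if h : i < n then r i h else x₀) n
  have hs : ∀ n, s n = c n fun i => if i < n then s i else x₀ := fun n => by
    simp only [s]
    rw [Nat.strongRec]
    simp
  refine ⟨s, fun n => ?_⟩
  have := hc n fun i => if i < n then s i else x₀
  rw [← hs n] at this
  exact hcongr n _ s (s n) (fun i hi => if_pos hi) this

/-- The requirements on the sequence of parameters. -/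
structure GoodSeq (α : ℝ) (q : ℕ → ℕ) : Prop where
  pos : ∀ n, 0 < q n
  le : ∀ n, n ≤ q n
  growth : ∀ n, 16 * q n ^ (n + 1) ≤ q (n + 1)
  step : ∀ n a, GoodStep α n (word q a n) (q n)

theorem exists_goodSeq {α : ℝ} (hα : Liouville α) : ∃ q, GoodSeq α q := by
  obtain ⟨q, hq⟩ := exists_seq_of_forall_exists (X := ℕ)
    (fun n s x => (0 < x ∧ n ≤ x ∧ ∀ i < n, 16 * s i ^ (i + 1) ≤ x) ∧
      ∀ a, GoodStep α n (word s a n) x)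
    (fun n s => by
      obtain ⟨q, hq, h⟩ := exists_goodStep hα n (finite_range_word s n)
        (by rintro _ ⟨a, rfl⟩; exact smoothUnit_word s a n)
        -- One lower bound covers positivity, `n ≤ q n` and growth, since each summand is at most
        -- the sum.
        (1 + n + ∑ i ∈ Finset.range n, 16 * s i ^ (i + 1))
      refine ⟨q, ⟨by omega, by omega, fun i hi => ?_⟩, fun a => h _ ⟨a, rfl⟩⟩
      have := Finset.single_le_sum (f := fun i => 16 * s i ^ (i + 1)) (fun _ _ => Nat.zero_le _)
        (Finset.mem_range.2 hi)
      omega)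
    (fun n s t x hst h => by
      refine ⟨⟨h.1.1, h.1.2.1, fun i hi => hst i hi ▸ h.1.2.2 i hi⟩, fun a => ?_⟩
      rw [← word_congr hst fun _ _ => rfl]
      exact h.2 a)
  exact ⟨q, fun n => (hq n).1.1, fun n => (hq n).1.2.1,
    fun n => (hq (n + 1)).1.2.2 n n.lt_succ_self, fun n a => (hq n).2 a⟩

/-! ### Limits -/

theorem continuous_unit (u : CircleDeg1Liftˣ) : Continuous u :=
  (CircleDeg1Lift.toOrderIso u).continuous

theorem exists_limit_lift {u : ℕ → CircleDeg1Lift} (hc : ∀ n, Continuous (u n))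
    (h : ∀ n x, |u (n + 1) x - u n x| ≤ (1 / 2) ^ n) :
    ∃ F : CircleDeg1Lift, Continuous F ∧ ∀ n x, |u n x - F x| ≤ 2 * (1 / 2) ^ n := by
  have hd : ∀ x n, dist (u n x) (u (n + 1) x) ≤ 1 * (1 / 2) ^ n := fun x n => by
    rw [dist_comm, Real.dist_eq, one_mul]
    exact h n x
  have hlim : ∀ x, ∃ y, Tendsto (fun n => u n x) atTop (𝓝 y) := fun x =>
    cauchySeq_tendsto_of_complete (cauchySeq_of_le_geometric (1 / 2) 1 (by norm_num) (hd x))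
  choose F hF using hlim
  have hb : ∀ n x, |u n x - F x| ≤ 2 * (1 / 2) ^ n := fun n x => by
    have := dist_le_of_le_geometric_of_tendsto (1 / 2) 1 (by norm_num) (hd x) (hF x) n
    rw [Real.dist_eq] at this
    convert this using 1
    ring
  have hFc : Continuous F := by
    refine TendstoUniformly.continuous (F := fun n => ⇑(u n)) (p := atTop) ?_
      (Eventually.frequently (Eventually.of_forall hc))
    rw [Metric.tendstoUniformly_iff]
    intro ε hε
    have h0 : Tendsto (fun n : ℕ => 2 * (1 / 2 : ℝ) ^ n) atTop (𝓝 (2 * 0)) :=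
      (tendsto_pow_atTop_nhds_zero_of_lt_one (by norm_num) (by norm_num)).const_mul 2
    rw [mul_zero] at h0
    filter_upwards [h0.eventually_lt_const hε] with n hn x
    rw [dist_comm, Real.dist_eq]
    exact (hb n x).trans_lt hn
  refine ⟨⟨⟨F, fun x y hxy => ?_⟩, fun x => ?_⟩, hFc, hb⟩
  · exact le_of_tendsto_of_tendsto' (hF x) (hF y) fun n => (u n).monotone hxy
  · refine tendsto_nhds_unique (hF (x + 1)) ?_
    simp only [CircleDeg1Lift.map_add_one]
    exact (hF x).add_const 1

theorem tendsto_zero_two_mul_half_pow : Tendsto (fun n : ℕ => 2 * (1 / 2 : ℝ) ^ n) atTop (𝓝 0) := by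
  simpa using (tendsto_pow_atTop_nhds_zero_of_lt_one (r := (1 / 2 : ℝ)) (by norm_num)
    (by norm_num)).const_mul 2

theorem tendsto_apply_of_uniform {u : ℕ → ℝ → ℝ} {F : ℝ → ℝ} (hF : Continuous F)
    (h : ∀ n x, |u n x - F x| ≤ 2 * (1 / 2) ^ n) {y : ℕ → ℝ} {z : ℝ}
    (hy : Tendsto y atTop (𝓝 z)) : Tendsto (fun n => u n (y n)) atTop (𝓝 (F z)) := by
  have h1 : Tendsto (fun n => u n (y n) - F (y n)) atTop (𝓝 0) :=
    squeeze_zero_norm (fun n => h n (y n)) tendsto_zero_two_mul_half_pow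
  simpa using h1.add ((hF.tendsto z).comp hy)

/-- A uniform limit of homeomorphisms need not be injective, so convergence of the inverses is
assumed too; the two limits are then mutually inverse. -/
theorem exists_limit_unit {u : ℕ → CircleDeg1Liftˣ}
    (h : ∀ n x, |u (n + 1) x - u n x| ≤ (1 / 2) ^ n)
    (h' : ∀ n x, |(u (n + 1))⁻¹ x - (u n)⁻¹ x| ≤ (1 / 2) ^ n) :
    ∃ H : CircleDeg1Liftˣ, (∀ n x, |u n x - H x| ≤ 2 * (1 / 2) ^ n) ∧
      ∀ n x, |(u n)⁻¹ x - H⁻¹ x| ≤ 2 * (1 / 2) ^ n := by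
  obtain ⟨F, hFc, hF⟩ := exists_limit_lift (u := fun n => u n) (fun n => continuous_unit _) h
  obtain ⟨G, hGc, hG⟩ := exists_limit_lift (u := fun n => ((u n)⁻¹ : CircleDeg1Liftˣ))
    (fun n => continuous_unit _) h'
  have hFG : F * G = 1 := by
    ext x
    have h1 : Tendsto (fun n => (u n)⁻¹ x) atTop (𝓝 (G x)) :=
      tendsto_apply_of_uniform (u := fun n => ((u n)⁻¹ : CircleDeg1Liftˣ)) hGc hG
        tendsto_const_nhds
    have h2 := tendsto_apply_of_uniform (u := fun n => u n) hFc hF h1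
    simp only [CircleDeg1Lift.units_apply_inv_apply] at h2
    exact tendsto_nhds_unique h2 tendsto_const_nhds
  have hGF : G * F = 1 := by
    ext x
    have h1 : Tendsto (fun n => u n x) atTop (𝓝 (F x)) :=
      tendsto_apply_of_uniform (u := fun n => u n) hFc hF tendsto_const_nhds
    have h2 := tendsto_apply_of_uniform (u := fun n => ((u n)⁻¹ : CircleDeg1Liftˣ)) hGc hG h1
    simp only [CircleDeg1Lift.units_inv_apply_apply] at h2
    exact tendsto_nhds_unique h2 tendsto_const_nhds
  exact ⟨⟨F, G, hFG, hGF⟩, hF, hG⟩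

/-- A sequence converging geometrically in all `C^n` norms has a smooth limit. -/
theorem derivBound_limit {F : ℕ → ℝ → ℝ} {G : ℝ → ℝ} (hF : ∀ n, ContDiff ℝ ∞ (F n))
    (h : ∀ n, DerivBound 0 n (fun x => F (n + 1) x - F n x) ((1 / 2) ^ n))
    (hG : ∀ x, Tendsto (fun n => F n x) atTop (𝓝 (G x))) (n : ℕ) :
    DerivBound 0 n (fun x => G x - F n x) (2 * (1 / 2) ^ n) := by
  have hsum : ∀ n : ℕ, HasSum (fun j : ℕ => (1 / 2 : ℝ) ^ (n + j)) (2 * (1 / 2) ^ n) := fun n => by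
    simp only [pow_add]
    have := hasSum_geometric_two.mul_left ((1 / 2 : ℝ) ^ n)
    rwa [mul_comm] at this
  have hbd : ∀ n k j x, k ≤ n → ‖iteratedFDeriv ℝ k (fun x => F (n + j + 1) x - F (n + j) x) x‖ ≤
      (1 / 2) ^ (n + j) := fun n k j x hk => by
    rw [norm_iteratedFDeriv_eq_norm_iteratedDeriv]
    exact (h (n + j)).2 k (Nat.zero_le _) (by omega) x
  have hsm : ∀ n j : ℕ, ContDiff ℝ ((n : ℕ∞) : WithTop ℕ∞) fun x => F (n + j + 1) x - F (n + j) x :=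
    fun n j => (h (n + j)).1.of_le (by exact_mod_cast le_top)
  -- The difference is a telescoping series that can be differentiated termwise up to order `n`: its
  -- term `j` is controlled up to order `n + j`.
  have heq : ∀ n, (fun x => G x - F n x) = fun x => ∑' j, (F (n + j + 1) x - F (n + j) x) :=
    fun n => by
      ext x
      have hs : Summable fun j => F (n + j + 1) x - F (n + j) x := by
        refine Summable.of_norm_bounded (hsum n).summable fun j => ?_
        have := (h (n + j)).2 0 le_rfl (Nat.zero_le _) x
        rwa [iteratedDeriv_zero] at this
      have h1 := hs.hasSum.tendsto_sum_nat
      have h2 : ∀ m, ∑ j ∈ Finset.range m, (F (n + j + 1) x - F (n + j) x) =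
          F (m + n) x - F n x := fun m => by
        rw [add_comm m n]
        exact Finset.sum_range_sub (fun j => F (n + j) x) m
      simp only [h2] at h1
      exact tendsto_nhds_unique (((tendsto_add_atTop_iff_nat n).2 (hG x)).sub_const _) h1
  have hGs : ContDiff ℝ ∞ G := by
    rw [contDiff_infty]
    intro n
    have h1 : ContDiff ℝ ((n : ℕ∞) : WithTop ℕ∞) fun x => G x - F n x := by
      rw [heq n]
      exact contDiff_tsum (v := fun _ j => (1 / 2) ^ (n + j)) (hsm n)
        (fun k _ => (hsum n).summable) fun k j x hk => hbd n k j x (by exact_mod_cast hk)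
    have h2 := h1.add ((hF n).of_le (m := ((n : ℕ∞) : WithTop ℕ∞)) (by exact_mod_cast le_top))
    simpa using h2
  refine ⟨hGs.sub (hF n), fun i _ hi x => ?_⟩
  rw [← Real.norm_eq_abs, ← norm_iteratedFDeriv_eq_norm_iteratedDeriv, heq n,
    iteratedFDeriv_tsum_apply (N := n) (v := fun _ j => (1 / 2) ^ (n + j)) (hsm n)
      (fun k _ => (hsum n).summable) (fun k j x hk => hbd n k j x (by exact_mod_cast hk))
      (by exact_mod_cast hi)]
  exact tsum_of_norm_bounded (hsum n) fun j => hbd n i j x hi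

/-! ### Infinite words and the rotations conjugated by them -/

namespace GoodSeq

variable {α : ℝ} {q : ℕ → ℕ}

/-- A map of degree one moves `0` and `1` to points at distance exactly one, so its Lipschitz
constant is at least one. -/
theorem two_pow_le (hq : GoodSeq α q) (n : ℕ) : (2 : ℝ) ^ n ≤ q n := by
  have h := (hq.step n fun _ => false).lipschitz 1 0
  have h1 := (word q (fun _ => false) n : CircleDeg1Lift).map_add_one 0
  rw [zero_add] at h1
  rw [h1] at h
  simpa using h

theorem abs_step_le (hq : GoodSeq α q) (a : ℕ → Bool) (n : ℕ) (x : ℝ) :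
    |(bif a n then (squeeze n (q n))⁻¹ else 1 : CircleDeg1Liftˣ) x - x| ≤ 1 / q n := by
  cases a n
  · simp
  · exact abs_squeeze_inv_sub_le n (hq.pos n) x

theorem abs_step_inv_le (hq : GoodSeq α q) (a : ℕ → Bool) (n : ℕ) (x : ℝ) :
    |(bif a n then (squeeze n (q n))⁻¹ else 1 : CircleDeg1Liftˣ)⁻¹ x - x| ≤ 1 / q n := by
  cases a n
  · simp
  · simpa using abs_squeeze_sub_le n (hq.pos n) x

/-- The infinite words. -/
theorem exists_limit_word (hq : GoodSeq α q) (a : ℕ → Bool) : ∃ H : CircleDeg1Liftˣ,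
    (∀ n x, |word q a n x - H x| ≤ 2 * (1 / 2) ^ n) ∧
      ∀ n x, |(word q a n)⁻¹ x - H⁻¹ x| ≤ 2 * (1 / 2) ^ n := by
  refine exists_limit_unit (fun n x => ?_) fun n x => ?_
  · have h1 := (hq.step n a).lipschitz
      ((bif a n then (squeeze n (q n))⁻¹ else 1 : CircleDeg1Liftˣ) x) x
    have h2 := hq.abs_step_le a n x
    have hpos : (0 : ℝ) < q n := by exact_mod_cast hq.pos n
    have h3 := h1.trans (mul_le_mul_of_nonneg_left h2 hpos.le)
    rw [mul_one_div_cancel hpos.ne'] at h3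
    rw [one_div, inv_pow, ← one_div, le_div_iff₀ (by positivity), mul_comm]
    exact h3
  -- In the inverse word the new block is applied last, so its displacement `1 / q n` is not
  -- magnified by the prefix.
  · rw [word, mul_inv_rev]
    refine (hq.abs_step_inv_le a n _).trans ?_
    rw [one_div_pow]
    exact one_div_le_one_div_of_le (by positivity) (hq.two_pow_le n)

end GoodSeq

/-- The infinite word with parameters `q i`, over the `i` with `a i = true`. -/
noncomputable def limWord (q : ℕ → ℕ) (a : ℕ → Bool) : CircleDeg1Liftˣ :=
  Classical.epsilon fun H : CircleDeg1Liftˣ => (∀ n x, |word q a n x - H x| ≤ 2 * (1 / 2) ^ n) ∧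
    ∀ n x, |(word q a n)⁻¹ x - H⁻¹ x| ≤ 2 * (1 / 2) ^ n

namespace GoodSeq

variable {α : ℝ} {q : ℕ → ℕ}

theorem abs_word_sub_le (hq : GoodSeq α q) (a : ℕ → Bool) (n : ℕ) (x : ℝ) :
    |word q a n x - limWord q a x| ≤ 2 * (1 / 2) ^ n :=
  (Classical.epsilon_spec (hq.exists_limit_word a)).1 n x

theorem abs_word_inv_sub_le (hq : GoodSeq α q) (a : ℕ → Bool) (n : ℕ) (x : ℝ) :
    |(word q a n)⁻¹ x - (limWord q a)⁻¹ x| ≤ 2 * (1 / 2) ^ n :=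
  (Classical.epsilon_spec (hq.exists_limit_word a)).2 n x

theorem tendsto_word (hq : GoodSeq α q) (a : ℕ → Bool) {y : ℕ → ℝ} {z : ℝ}
    (hy : Tendsto y atTop (𝓝 z)) :
    Tendsto (fun n => word q a n (y n)) atTop (𝓝 (limWord q a z)) :=
  tendsto_apply_of_uniform (continuous_unit _) (hq.abs_word_sub_le a) hy

theorem tendsto_word_inv (hq : GoodSeq α q) (a : ℕ → Bool) (x : ℝ) :
    Tendsto (fun n => (word q a n)⁻¹ x) atTop (𝓝 ((limWord q a)⁻¹ x)) :=
  tendsto_apply_of_uniform (u := fun n => ((word q a n)⁻¹ : CircleDeg1Liftˣ)) (continuous_unit _)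
    (hq.abs_word_inv_sub_le a) tendsto_const_nhds

/-- The remaining part of an infinite word is close to the identity. -/
theorem abs_tail_sub_le (hq : GoodSeq α q) (a : ℕ → Bool) (n : ℕ) (x : ℝ) :
    |((word q a n)⁻¹ * limWord q a) x - x| ≤ 2 / q n := by
  -- The first block of the tail is split off, which is why `n` varies in the induction: it
  -- contributes `1 / q n`, and the rest at most `2 / q (n + 1) ≤ 1 / q n` by the growth condition.
  have key : ∀ d n x, |((word q a n)⁻¹ * word q a (n + d)) x - x| ≤ 2 / q n := by
    intro d
    induction d with
    | zero =>
      intro n x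
      simp only [add_zero, inv_mul_cancel, Units.val_one, CircleDeg1Lift.coe_one, id, sub_self,
        abs_zero]
      positivity
    | succ d ih =>
      intro n x
      set g : CircleDeg1Liftˣ := bif a n then (squeeze n (q n))⁻¹ else 1 with hg
      have e : (word q a n)⁻¹ * word q a (n + (d + 1)) =
          g * ((word q a (n + 1))⁻¹ * word q a (n + 1 + d)) := by
        rw [show n + (d + 1) = n + 1 + d by omega]
        conv_rhs => rw [word, ← hg, mul_inv_rev]
        group
      rw [e]
      set y := ((word q a (n + 1))⁻¹ * word q a (n + 1 + d)) x with hy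
      have h1 : |g y - y| ≤ 1 / q n := hq.abs_step_le a n y
      have h2 : |y - x| ≤ 2 / q (n + 1) := ih (n + 1) x
      have hpos : (0 : ℝ) < q n := by exact_mod_cast hq.pos n
      have h3 : (2 : ℝ) / q (n + 1) ≤ 1 / q n := by
        have h4 : 2 * q n ≤ q (n + 1) := by
          refine le_trans ?_ (hq.growth n)
          have : q n ≤ q n ^ (n + 1) := Nat.le_self_pow (by omega) _
          omega
        have h5 : (2 : ℝ) * q n ≤ q (n + 1) := by exact_mod_cast h4
        rw [div_le_div_iff₀ (by exact_mod_cast hq.pos (n + 1)) hpos]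
        linarith
      calc |g y - x| ≤ |g y - y| + |y - x| := abs_sub_le _ _ _
        _ ≤ 1 / q n + 1 / q n := add_le_add h1 (h2.trans h3)
        _ = 2 / q n := by ring
  have h1 : Tendsto (fun m => word q a (m + n) x) atTop (𝓝 (limWord q a x)) :=
    (tendsto_add_atTop_iff_nat n).2 (hq.tendsto_word a (tendsto_const_nhds (x := x)))
  have h2 := (((continuous_unit (word q a n)⁻¹).tendsto _).comp h1).sub_const x
  refine le_of_tendsto h2.abs (Eventually.of_forall fun d => ?_)
  have := key d n x
  rw [add_comm] at this
  exact this

theorem derivBound_word_succ (hq : GoodSeq α q) (a : ℕ → Bool) {β : ℝ} (hβ : β = α ∨ β = -α)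
    (n : ℕ) : DerivBound 0 n (fun x => (word q a (n + 1) * transl β * (word q a (n + 1))⁻¹) x -
      (word q a n * transl β * (word q a n)⁻¹) x) ((1 / 2) ^ n) := by
  rw [word]
  cases a n
  · simp only [cond_false, mul_one, sub_self]
    refine (DerivBound.const n 0).mono le_rfl le_rfl ?_
    rw [abs_zero]
    positivity
  · rcases hβ with rfl | rfl
    · exact (hq.step n a).small
    · exact (hq.step n a).small_neg

theorem derivBound_limWord_sub (hq : GoodSeq α q) (a : ℕ → Bool) {β : ℝ} (hβ : β = α ∨ β = -α)
    (n : ℕ) : DerivBound 0 n (fun x => (limWord q a * transl β * (limWord q a)⁻¹) x -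
      (word q a n * transl β * (word q a n)⁻¹) x) (2 * (1 / 2) ^ n) := by
  refine derivBound_limit
    (F := fun n => (word q a n * transl β * (word q a n)⁻¹ : CircleDeg1Liftˣ))
    (fun n => (((smoothUnit_word q a n).mul (smoothUnit_transl β)).mul
      (smoothUnit_word q a n).inv).1) (hq.derivBound_word_succ a hβ) (fun x => ?_) n
  exact hq.tendsto_word a ((hq.tendsto_word_inv a x).const_add β)

/-- Both conjugates are within `2 * (1/2) ^ n` of the one given by the common prefix. This is the
modulus of continuity of the reduction. -/
theorem derivBound_limWord_sub_limWord (hq : GoodSeq α q) {a b : ℕ → Bool} {β : ℝ}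
    (hβ : β = α ∨ β = -α) {n : ℕ} (hab : ∀ i < n, a i = b i) :
    DerivBound 0 n (fun x => (limWord q a * transl β * (limWord q a)⁻¹) x -
      (limWord q b * transl β * (limWord q b)⁻¹) x) (4 * (1 / 2) ^ n) := by
  have h1 := hq.derivBound_limWord_sub a hβ n
  have h2 := (hq.derivBound_limWord_sub b hβ n).neg
  rw [word_congr (fun _ _ => rfl) hab] at h1
  convert h1.add h2 using 1
  · ext x
    ring
  · ring

theorem contDiff_conj_limWord (hq : GoodSeq α q) (a : ℕ → Bool) {β : ℝ} (hβ : β = α ∨ β = -α) :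
    ContDiff ℝ ∞ (limWord q a * transl β * (limWord q a)⁻¹ : CircleDeg1Liftˣ) := by
  have h := (hq.derivBound_limWord_sub a hβ 0).1.add (((smoothUnit_word q a 0).mul
    (smoothUnit_transl β)).mul (smoothUnit_word q a 0).inv).1
  simpa only [sub_add_cancel] using h

theorem inv_conj_transl (H : CircleDeg1Liftˣ) (t : ℝ) :
    (H * transl t * H⁻¹)⁻¹ = H * transl (-t) * H⁻¹ := by
  rw [mul_inv_rev, mul_inv_rev, inv_inv, mul_assoc]
  congr 2
  ext x
  rfl

theorem smoothUnit_conj_limWord (hq : GoodSeq α q) (a : ℕ → Bool) :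
    SmoothUnit (limWord q a * transl α * (limWord q a)⁻¹) := by
  refine ⟨hq.contDiff_conj_limWord a (Or.inl rfl), ?_⟩
  rw [inv_conj_transl]
  exact hq.contDiff_conj_limWord a (Or.inr rfl)

/-- Infinite words with the same tail differ by a smooth factor. -/
theorem limWord_eq (hq : GoodSeq α q) {a b : ℕ → Bool} {n : ℕ} (hab : ∀ i ≥ n, a i = b i) :
    limWord q a = word q a n * (word q b n)⁻¹ * limWord q b := by
  have key : ∀ d, word q a (d + n) = word q a n * (word q b n)⁻¹ * word q b (d + n) := by
    intro d
    induction d with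
    | zero => simp
    | succ d ih =>
      rw [show d + 1 + n = d + n + 1 by omega, word, word, ih, hab (d + n) (by omega)]
      simp only [mul_assoc]
  ext x
  have h1 : Tendsto (fun m => word q a (m + n) x) atTop (𝓝 (limWord q a x)) :=
    (tendsto_add_atTop_iff_nat n).2 (hq.tendsto_word a (tendsto_const_nhds (x := x)))
  have h2 : Tendsto (fun m => word q b (m + n) x) atTop (𝓝 (limWord q b x)) :=
    (tendsto_add_atTop_iff_nat n).2 (hq.tendsto_word b (tendsto_const_nhds (x := x)))
  have h3 := ((continuous_unit (word q a n * (word q b n)⁻¹)).tendsto _).comp h2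
  simp only [key] at h1
  exact tendsto_nhds_unique h1 h3

end GoodSeq

/-! ### Circle homeomorphisms with a given lift -/

/-- The circle map with lift `F`. -/
noncomputable def circMap (F : CircleDeg1Lift) : Circ → Circ :=
  Function.Periodic.lift (f := fun x : ℝ => ((F x : ℝ) : Circ)) (c := 1) fun x => by
    change ((F (x + 1) : ℝ) : Circ) = F x
    rw [F.map_add_one, AddCircle.coe_add, AddCircle.coe_period, add_zero]

theorem circMap_coe (F : CircleDeg1Lift) (x : ℝ) : circMap F (x : Circ) = ((F x : ℝ) : Circ) := rfl

theorem continuous_circMap (u : CircleDeg1Liftˣ) : Continuous (circMap u) :=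
  continuous_coinduced_dom.2 ((AddCircle.continuous_mk' 1).comp (continuous_unit u))

/-- The circle homeomorphism with lift `u`. -/
noncomputable def toCirc : CircleDeg1Liftˣ →* (Circ ≃ₜ Circ) where
  toFun u :=
    { toFun := circMap u
      invFun := circMap (u⁻¹ : CircleDeg1Liftˣ)
      left_inv := by
        rintro ⟨x⟩
        change circMap _ (circMap _ (x : Circ)) = (x : Circ)
        rw [circMap_coe, circMap_coe, CircleDeg1Lift.units_inv_apply_apply]
      right_inv := by
        rintro ⟨x⟩
        change circMap _ (circMap _ (x : Circ)) = (x : Circ)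
        rw [circMap_coe, circMap_coe, CircleDeg1Lift.units_apply_inv_apply]
      continuous_toFun := continuous_circMap u
      continuous_invFun := continuous_circMap u⁻¹ }
  map_one' := by
    ext x
    obtain ⟨x, rfl⟩ := QuotientAddGroup.mk_surjective x
    rfl
  map_mul' u v := by
    ext x
    obtain ⟨x, rfl⟩ := QuotientAddGroup.mk_surjective x
    rfl

theorem toCirc_coe (u : CircleDeg1Liftˣ) (x : ℝ) : toCirc u (x : Circ) = ((u x : ℝ) : Circ) := rfl

theorem toCirc_transl (t : ℝ) (x : Circ) : toCirc (transl t) x = t + x := by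
  obtain ⟨x, rfl⟩ := QuotientAddGroup.mk_surjective x
  rfl

theorem isLift_toCirc (u : CircleDeg1Liftˣ) : IsLift u (toCirc u) :=
  ⟨continuous_unit u, fun _ => rfl⟩

theorem toCirc_symm (u : CircleDeg1Liftˣ) : (toCirc u).symm = toCirc u⁻¹ := rfl

theorem toCirc_mem_diffeo {u : CircleDeg1Liftˣ} (hu : SmoothUnit u) : toCirc u ∈ Diffeo ⊤ :=
  ⟨⟨u, isLift_toCirc u, hu.1⟩, (u⁻¹ : CircleDeg1Liftˣ), isLift_toCirc u⁻¹, hu.2⟩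

theorem rotationNumber_conj_transl (H : CircleDeg1Liftˣ) (α : ℝ) :
    rotationNumber (toCirc (H * transl α * H⁻¹)) = α := by
  rw [rotationNumber_eq (isLift_toCirc _)]
  congr 1
  exact (CircleDeg1Lift.translationNumber_conj_eq H (transl α : CircleDeg1Lift)).trans
    (CircleDeg1Lift.translationNumber_translate α)

theorem dist_coe_le (x y : ℝ) : dist (x : Circ) (y : Circ) ≤ |x - y| := by
  rw [dist_eq_norm, ← AddCircle.coe_sub, UnitAddCircle.norm_eq]
  simpa using round_le (x - y) 0

theorem dist_coe_eq {x y : ℝ} (h : |x - y| ≤ 1 / 2) : dist (x : Circ) (y : Circ) = |x - y| := by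
  rw [dist_eq_norm, ← AddCircle.coe_sub]
  exact (AddCircle.norm_coe_eq_abs_iff 1 one_ne_zero).2 (by simpa using h)

/-- The lift selected by `lift` differs from `u` by an integer constant, which differentiation
removes. -/
theorem iteratedDeriv_lift_toCirc (u : CircleDeg1Liftˣ) {i : ℕ} (hi : i ≠ 0) :
    iteratedDeriv i (lift (toCirc u)) = iteratedDeriv i u := by
  obtain ⟨m, hm⟩ := (isLift_lift ⟨_, isLift_toCirc u⟩).unique (isLift_toCirc u)
  obtain ⟨j, rfl⟩ := Nat.exists_eq_succ_of_ne_zero hi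
  rw [funext hm, iteratedDeriv_succ', iteratedDeriv_succ']
  congr 1
  ext x
  simp

theorem normDiff_toCirc_le {u v : CircleDeg1Liftˣ} (hu : ContDiff ℝ ∞ u) (hv : ContDiff ℝ ∞ v)
    {k : ℕ} {A : ℝ} (h : DerivBound 0 k (fun x => u x - v x) A) :
    normDiff k (toCirc u) (toCirc v) ≤ A := by
  refine ciSup_le fun i => ?_
  have hi := Nat.le_of_lt_succ i.2
  unfold derivDist
  split_ifs with h0
  · refine ciSup_le fun x => ?_
    obtain ⟨x, rfl⟩ := QuotientAddGroup.mk_surjective x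
    refine (dist_coe_le (u x) (v x)).trans ?_
    simpa using h.2 0 le_rfl (Nat.zero_le k) x
  · refine ciSup_le fun x => ?_
    rw [iteratedDeriv_lift_toCirc u h0, iteratedDeriv_lift_toCirc v h0,
      ← iteratedDeriv_fun_sub (hu.of_le (DerivBound.natCast_le_infty _)).contDiffAt
        (hv.of_le (DerivBound.natCast_le_infty _)).contDiffAt]
    exact h.2 i (Nat.zero_le _) hi x

/-- A map commuting with an irrational rotation commutes with all rotations. -/
theorem map_add_of_irrational {α : ℝ} (hα : Irrational α) {g : Circ → Circ} (hg : Continuous g)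
    (h : ∀ x, g (α + x) = α + g x) (t x : Circ) : g (t + x) = t + g x := by
  -- The translations commuting with `g` form a subgroup containing `α`, hence all its multiples;
  -- these are dense, and continuity of `g` gives the rest.
  let S : AddSubgroup Circ :=
    { carrier := {t | ∀ x, g (t + x) = t + g x}
      zero_mem' := fun x => by rw [zero_add, zero_add]
      add_mem' := fun {s t} hs ht x => by rw [add_assoc, hs, ht, add_assoc]
      neg_mem' := fun {t} ht x => by
        have := ht (-t + x)
        rw [add_neg_cancel_left] at this
        rw [this, neg_add_cancel_left] }
  have hd : DenseRange fun n : ℤ => n • (α : Circ) :=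
    AddCircle.denseRange_zsmul_coe_iff.2 (by simpa using hα)
  have h1 : (fun t => g (t + x)) = fun t => t + g x := by
    refine hd.equalizer (hg.comp (continuous_id.add continuous_const))
      (continuous_id.add continuous_const) ?_
    ext n
    exact S.zsmul_mem (show (α : Circ) ∈ S from h) n x
  exact congrFun h1 t

/-- Conjugacies between two conjugates of an irrational rotation. -/
theorem eq_toCirc_of_conj {α : ℝ} (hα : Irrational α) {H K : CircleDeg1Liftˣ} {h : Circ ≃ₜ Circ}
    (hc : toCirc (H * transl α * H⁻¹) = h * toCirc (K * transl α * K⁻¹) * h⁻¹) :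
    ∃ t : ℝ, h = toCirc (H * transl t * K⁻¹) := by
  -- In the coordinates given by `H` and `K` the conjugacy commutes with the rotation by `α`, so it
  -- is the rotation by `g 0`.
  set g : Circ ≃ₜ Circ := (toCirc H)⁻¹ * h * toCirc K with hg
  have hcomm : g * toCirc (transl α) = toCirc (transl α) * g := by
    have h1 : h * toCirc (K * transl α * K⁻¹) = toCirc (H * transl α * H⁻¹) * h := by
      rw [hc]
      group
    simp only [map_mul, map_inv] at h1
    calc g * toCirc (transl α) = (toCirc H)⁻¹ *
          (h * (toCirc K * toCirc (transl α) * (toCirc K)⁻¹)) * toCirc K := by rw [hg]; group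
      _ = toCirc (transl α) * g := by rw [h1, hg]; group
  have h2 : ∀ x, g (α + x) = α + g x := fun x => by
    have := congrArg (fun f : Circ ≃ₜ Circ => f x) hcomm
    simpa only [Homeomorph.mul_apply, toCirc_transl] using this
  obtain ⟨t, ht⟩ := QuotientAddGroup.mk_surjective (g 0)
  refine ⟨t, ?_⟩
  have h3 : g = toCirc (transl t) := by
    ext x
    have := map_add_of_irrational hα g.continuous h2 x 0
    rw [add_zero] at this
    rw [this, toCirc_transl, ← ht, add_comm]
  rw [map_mul, map_mul, map_inv, ← h3, hg]
  group

/-! ### Conjugacies between infinite words which are not Hölder continuous -/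

namespace GoodSeq

variable {α : ℝ} {q : ℕ → ℕ}

/-- The conjugacy stretches a short interval, if `a` involves the block `n` and `b` does not. -/
theorem exists_stretched_interval (hq : GoodSeq α q) {a b : ℕ → Bool} {n : ℕ} (ha : a n = true)
    (hb : b n = false) (t : ℝ) : ∃ x y : ℝ, |x - y| ≤ factor n (q n) ∧
      1 / (2 * (q n : ℝ) ^ 2) ≤ |(limWord q a * transl t * (limWord q b)⁻¹) x -
        (limWord q a * transl t * (limWord q b)⁻¹) y| ∧
      |(limWord q a * transl t * (limWord q b)⁻¹) x -
        (limWord q a * transl t * (limWord q b)⁻¹) y| ≤ 1 / 2 := by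
  set Q := q n with hQ
  have hpos : (0 : ℝ) < Q := by exact_mod_cast hq.pos n
  set A := word q a n with hA
  set B := word q b n with hB
  set S := squeeze n Q with hS
  have hA1 : word q a (n + 1) = A * S⁻¹ := by rw [word, ha, cond_true]
  have hB1 : word q b (n + 1) = B := by rw [word, hb, cond_false, mul_one]
  set η : ℝ := 2 / q (n + 1) with hη
  -- The constant `16` in the growth condition is made for this: the four tail errors together do
  -- not exceed the length of the squeezed interval.
  have hηle : 4 * η ≤ factor n Q / (2 * Q) := by
    have h1 : (16 : ℝ) * (Q : ℝ) ^ (n + 1) ≤ q (n + 1) := by exact_mod_cast hq.growth n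
    have h2 : η ≤ 2 / (16 * (Q : ℝ) ^ (n + 1)) := by
      rw [hη]
      gcongr
    calc 4 * η ≤ 4 * (2 / (16 * (Q : ℝ) ^ (n + 1))) := by linarith
      _ = factor n Q / (2 * Q) := by
        rw [factor, pow_succ]
        field_simp
        norm_num
  have hσ : ∀ x, |((limWord q a)⁻¹ * (A * S⁻¹)) x - x| ≤ η := fun x => by
    have := hq.abs_tail_sub_le a (n + 1) (((limWord q a)⁻¹ * (A * S⁻¹)) x)
    rw [hA1] at this
    have e : ((A * S⁻¹)⁻¹ * limWord q a) (((limWord q a)⁻¹ * (A * S⁻¹)) x) = x := by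
      rw [← CircleDeg1Lift.mul_apply, ← Units.val_mul]
      have : (A * S⁻¹)⁻¹ * limWord q a * ((limWord q a)⁻¹ * (A * S⁻¹)) = 1 := by group
      rw [this]
      rfl
    rwa [e, abs_sub_comm] at this
  have hτ : ∀ x, |(B⁻¹ * limWord q b) x - x| ≤ η := fun x => by
    have := hq.abs_tail_sub_le b (n + 1) x
    rwa [hB1] at this
  -- `X z` is the preimage of `A z` under the conjugacy. Up to the tails of the two words it equals
  -- `B (-t + S z)`: the block `S` survives because `a` contains it and `b` does not. Thus the
  -- interval from `z₁` to `z₂`, squeezed by `S`, has a very short preimage, while its image under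
  -- `A` stays comparatively long.
  let X : ℝ → ℝ := fun z => limWord q b (-t + (limWord q a)⁻¹ (A z))
  have hX : ∀ z, (limWord q a * transl t * (limWord q b)⁻¹) (X z) = A z := fun z => by
    change limWord q a (t + (limWord q b)⁻¹ (limWord q b (-t + (limWord q a)⁻¹ (A z)))) = A z
    rw [CircleDeg1Lift.units_inv_apply_apply, add_neg_cancel_left,
      CircleDeg1Lift.units_apply_inv_apply]
  set Y : ℝ → ℝ := fun z => (B⁻¹ * limWord q b) (-t + (limWord q a)⁻¹ (A z)) with hY
  have hXY : ∀ z, X z = B (Y z) := fun z =>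
    (CircleDeg1Lift.units_apply_inv_apply B _).symm
  have hYS : ∀ z, |Y z - (-t + S z)| ≤ 2 * η := fun z => by
    have h1 := hσ (S z)
    have e : ((limWord q a)⁻¹ * (A * S⁻¹)) (S z) = (limWord q a)⁻¹ (A z) := by
      change (limWord q a)⁻¹ (A (S⁻¹ (S z))) = _
      rw [CircleDeg1Lift.units_inv_apply_apply]
    rw [e] at h1
    have h2 := hτ (-t + (limWord q a)⁻¹ (A z))
    have e2 : Y z - (-t + S z) = (Y z - (-t + (limWord q a)⁻¹ (A z))) +
        ((limWord q a)⁻¹ (A z) - S z) := by ring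
    rw [e2]
    exact (abs_add_le _ _).trans (by linarith)
  set z₁ : ℝ := 1 / (2 * Q) with hz₁
  set z₂ : ℝ := 1 / Q with hz₂
  have hz : z₂ - z₁ = 1 / (2 * Q) := by
    rw [hz₁, hz₂]
    field_simp
    norm_num
  have hSz : S z₂ - S z₁ = factor n Q / (2 * Q) := squeeze_contracts n (hq.pos n)
  have hf := factor_pos n (hq.pos n)
  have h2n : (1 : ℝ) ≤ 2 ^ n := one_le_pow₀ (by norm_num)
  have hst := hq.step n a
  have hst' := hq.step n b
  refine ⟨X z₂, X z₁, ?_, ?_, ?_⟩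
  · rw [hXY, hXY]
    have h1 := hst'.lipschitz (Y z₂) (Y z₁)
    have h2 : |Y z₂ - Y z₁| ≤ factor n Q / Q := by
      have e : Y z₂ - Y z₁ = (Y z₂ - (-t + S z₂)) - (Y z₁ - (-t + S z₁)) + (S z₂ - S z₁) := by ring
      have h3 := hYS z₁
      have h4 := hYS z₂
      have h5 : factor n Q / (2 * Q) + factor n Q / (2 * Q) = factor n Q / Q := by
        field_simp
        norm_num
      rw [e, hSz]
      rw [abs_le] at h3 h4 ⊢
      have h6 : 0 ≤ factor n Q / (2 * Q) := by positivity
      constructor <;> linarith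
    calc |B (Y z₂) - B (Y z₁)| ≤ 2 ^ n * |B (Y z₂) - B (Y z₁)| :=
          le_mul_of_one_le_left (abs_nonneg _) h2n
      _ ≤ Q * |Y z₂ - Y z₁| := h1
      _ ≤ Q * (factor n Q / Q) := by gcongr
      _ = factor n Q := by field_simp
  · rw [hX, hX]
    have h1 := hst.lipschitz_inv (A z₂) (A z₁)
    rw [CircleDeg1Lift.units_inv_apply_apply, CircleDeg1Lift.units_inv_apply_apply, hz,
      abs_of_pos (by positivity)] at h1
    have h2 : 1 / (2 * (Q : ℝ)) ≤ Q * |A z₂ - A z₁| :=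
      (le_mul_of_one_le_left (by positivity) h2n).trans h1
    calc 1 / (2 * (Q : ℝ) ^ 2) = 1 / (2 * Q) / Q := by field_simp
      _ ≤ |A z₂ - A z₁| := by
        exact (div_le_iff₀ hpos).2 (h2.trans_eq (mul_comm _ _))
  · rw [hX, hX]
    have h1 := hst.lipschitz z₂ z₁
    rw [hz, abs_of_pos (a := 1 / (2 * (Q : ℝ))) (by positivity)] at h1
    calc |A z₂ - A z₁| ≤ 2 ^ n * |A z₂ - A z₁| := le_mul_of_one_le_left (abs_nonneg _) h2n
      _ ≤ Q * (1 / (2 * Q)) := h1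
      _ = 1 / 2 := by field_simp

theorem not_holderWith (hq : GoodSeq α q) {a b : ℕ → Bool}
    (hab : ∃ᶠ n in atTop, a n = true ∧ b n = false) (t : ℝ) {C β : ℝ≥0} (hβ : 0 < β) :
    ¬ HolderWith C β (toCirc (limWord q a * transl t * (limWord q b)⁻¹)) := by
  intro h
  have hβ' : (0 : ℝ) < β := hβ
  -- With `n β ≥ 3` the Hölder bound on the short interval is at most `C / Q³`, against a lower
  -- bound `1 / (2 Q²)`. This forces `Q ≤ 2 C`, contrary to `Q ≥ n > 2 C`.
  obtain ⟨n, ⟨ha, hb⟩, hn, hn'⟩ := (hab.and_eventually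
    ((tendsto_natCast_atTop_atTop.eventually_ge_atTop (3 / (β : ℝ))).and
      (tendsto_natCast_atTop_atTop.eventually_gt_atTop (2 * (C : ℝ))))).exists
  obtain ⟨x, y, hxy, h1, h2⟩ := hq.exists_stretched_interval ha hb t
  set u := limWord q a * transl t * (limWord q b)⁻¹ with hu
  have hQ1 : (1 : ℝ) ≤ q n := by exact_mod_cast hq.pos n
  have hQn : (n : ℝ) ≤ q n := by exact_mod_cast hq.le n
  set Q : ℝ := ((q n : ℕ) : ℝ) with hQ
  have h3 := h.dist_le_of_le (x := (x : Circ)) (y := (y : Circ)) ((dist_coe_le x y).trans hxy)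
  rw [toCirc_coe, toCirc_coe, dist_coe_eq h2] at h3
  have h4 : factor n (q n) ^ (β : ℝ) ≤ (Q ^ 3)⁻¹ := by
    rw [factor, Real.inv_rpow (by positivity), ← Real.rpow_natCast, ← Real.rpow_mul (by positivity),
      ← Real.rpow_natCast]
    refine inv_anti₀ (by positivity) (Real.rpow_le_rpow_of_exponent_le hQ1 ?_)
    rw [div_le_iff₀ hβ'] at hn
    exact_mod_cast hn
  have h5 : 1 / (2 * Q ^ 2) ≤ C * (Q ^ 3)⁻¹ :=
    h1.trans (h3.trans (mul_le_mul_of_nonneg_left h4 C.coe_nonneg))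
  rw [← div_eq_mul_inv, div_le_div_iff₀ (by positivity) (by positivity)] at h5
  have h6 : Q ≤ 2 * C := by
    have : Q ^ 2 * Q ≤ Q ^ 2 * (2 * C) := by nlinarith
    exact le_of_mul_le_mul_left this (by positivity)
  linarith

end GoodSeq

/-! ### The reduction -/

/-- A continuous self-map of the Cantor space with the property that any two sequences that
differ at infinitely many places have images `x`, `y` with infinitely many `n` such that
`x n = true` and `y n = false`. -/
def interleave (a : ℕ → Bool) (n : ℕ) : Bool := if n % 2 = 0 then a (n / 2) else !a (n / 2)

theorem interleave_congr {a b : ℕ → Bool} {n : ℕ} (h : a (n / 2) = b (n / 2)) :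
    interleave a n = interleave b n := by
  rw [interleave, interleave, h]

/-- A difference at `m` shows up at `2 m` if `a m` is true, and at `2 m + 1`, where the entries are
negated, if it is false. The order matters because only the conjugacy itself, not its inverse, is
assumed Hölder. -/
theorem frequently_interleave {a b : ℕ → Bool} (h : ¬ E₀ a b) :
    ∃ᶠ n in atTop, interleave a n = true ∧ interleave b n = false := by
  rw [frequently_atTop]
  intro N
  simp only [E₀, not_exists, not_forall] at h
  obtain ⟨m, hm, hab⟩ := h N
  cases ha : a m <;> cases hb : b m
  · exact absurd (ha.trans hb.symm) hab
  · refine ⟨2 * m + 1, by omega, ?_, ?_⟩ <;>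
    simp [interleave, show (2 * m + 1) / 2 = m by omega, ha, hb]
  · refine ⟨2 * m, by omega, ?_, ?_⟩ <;> simp [interleave, ha, hb]
  · exact absurd (ha.trans hb.symm) hab

/-- The diffeomorphism attached to a binary sequence. -/
noncomputable def conjRotation {α : ℝ} {q : ℕ → ℕ} (hq : GoodSeq α q) (a : ℕ → Bool) :
    SmoothDiffeoRot (α : Circ) :=
  ⟨⟨toCirc (limWord q a * transl α * (limWord q a)⁻¹),
    toCirc_mem_diffeo (hq.smoothUnit_conj_limWord a)⟩, rotationNumber_conj_transl _ α⟩

theorem GoodSeq.distCk_le {α : ℝ} {q : ℕ → ℕ} (hq : GoodSeq α q) {a b : ℕ → Bool} {k n : ℕ}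
    (hkn : k ≤ n) (hab : ∀ i < n, a i = b i) :
    distCk k (conjRotation hq a).1 (conjRotation hq b).1 ≤ 4 * (1 / 2) ^ n := by
  refine max_le ?_ ?_
  · exact normDiff_toCirc_le (hq.contDiff_conj_limWord a (Or.inl rfl))
      (hq.contDiff_conj_limWord b (Or.inl rfl))
      ((hq.derivBound_limWord_sub_limWord (Or.inl rfl) hab).mono le_rfl hkn le_rfl)
  · simp only [conjRotation]
    rw [toCirc_symm, toCirc_symm, inv_conj_transl, inv_conj_transl]
    exact normDiff_toCirc_le (hq.contDiff_conj_limWord a (Or.inr rfl))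
      (hq.contDiff_conj_limWord b (Or.inr rfl))
      ((hq.derivBound_limWord_sub_limWord (Or.inr rfl) hab).mono le_rfl hkn le_rfl)

/-- Each `d_k` tends to zero because nearby sequences share a long prefix. The series defining `d_∞`
is dominated by a geometric one, so the limit passes through the sum. -/
theorem GoodSeq.continuous_conjRotation {α : ℝ} {q : ℕ → ℕ} (hq : GoodSeq α q) :
    Continuous fun a => conjRotation hq (interleave a) := by
  rw [continuous_iff_continuousAt]
  intro a
  have hev : ∀ n : ℕ, ∀ᶠ b in 𝓝 a, ∀ i < n, interleave b i = interleave a i := fun n => by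
    have h1 : ∀ᶠ b in 𝓝 a, ∀ i ∈ Finset.range n, b i = a i := by
      rw [Filter.eventually_all_finset]
      intro i _
      have := (continuous_apply (A := fun _ : ℕ => Bool) i).tendsto a
      rwa [nhds_discrete Bool, tendsto_pure] at this
    filter_upwards [h1] with b hb i hi
    exact interleave_congr (hb _ (Finset.mem_range.2 (by omega)))
  have hk : ∀ k, Tendsto (fun b => distCk k (conjRotation hq (interleave b)).1
      (conjRotation hq (interleave a)).1) (𝓝 a) (𝓝 0) := fun k => by
    rw [Metric.tendsto_nhds]
    intro ε hε
    have h0 : Tendsto (fun n : ℕ => 4 * (1 / 2 : ℝ) ^ n) atTop (𝓝 0) := by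
      simpa using (tendsto_pow_atTop_nhds_zero_of_lt_one (r := (1 / 2 : ℝ)) (by norm_num)
        (by norm_num)).const_mul 4
    obtain ⟨n, hn, hkn⟩ := ((h0.eventually_lt_const hε).and (eventually_ge_atTop k)).exists
    filter_upwards [hev n] with b hb
    rw [Real.dist_eq, sub_zero, abs_of_nonneg (distCk_nonneg _ _ _)]
    exact (hq.distCk_le hkn hb).trans_lt hn
  rw [ContinuousAt, tendsto_iff_dist_tendsto_zero]
  change Tendsto (fun b => ∑' k : ℕ, _) _ _
  rw [← tsum_zero (α := ℝ) (β := ℕ)]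
  refine tendsto_tsum_of_dominated_convergence (bound := fun k => (1 / 2) ^ (k + 1))
    ((summable_nat_add_iff 1).2 (summable_geometric_of_lt_one (by norm_num) (by norm_num)))
    (fun k => ?_) (Eventually.of_forall fun b k => ?_)
  · refine squeeze_zero (fun b => distSmooth_term_nonneg (k + 1) _ _) (fun b => ?_) (hk (k + 1))
    refine div_le_self (distCk_nonneg _ _ _) ?_
    refine one_le_mul_of_one_le_of_one_le (one_le_pow₀ (by norm_num)) ?_
    have := distCk_nonneg (k + 1) (conjRotation hq (interleave b)).1
      (conjRotation hq (interleave a)).1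
    linarith
  · rw [Real.norm_of_nonneg (distSmooth_term_nonneg (k + 1) _ _)]
    exact distSmooth_term_le (k + 1) _ _

theorem GoodSeq.reduces {α : ℝ} (hα : Irrational α) {q : ℕ → ℕ} (hq : GoodSeq α q)
    {𝒟 : Set (Circ ≃ₜ Circ)} (h𝒟 : IsRegularityClass 𝒟) :
    Reduces E₀ (conjRel 𝒟 (α : Circ)) fun a => conjRotation hq (interleave a) := by
  intro a b
  constructor
  · rintro ⟨N, hN⟩
    -- For `i ≥ 2 N + 2` one has `i / 2 > N`, so the interleaved sequences agree from there on.
    have h1 := hq.limWord_eq (a := interleave a) (b := interleave b) (n := 2 * N + 2)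
      fun i hi => interleave_congr (hN _ (by omega))
    refine ⟨toCirc (word q (interleave a) (2 * N + 2) * (word q (interleave b) (2 * N + 2))⁻¹),
      h𝒟.1 (toCirc_mem_diffeo ((smoothUnit_word _ _ _).mul (smoothUnit_word _ _ _).inv)), ?_⟩
    simp only [conjRotation]
    rw [h1, ← map_inv, ← map_mul, ← map_mul]
    refine congrArg toCirc ?_
    simp only [mul_inv_rev, inv_inv, mul_assoc]
  · rintro ⟨h, hh, hc⟩
    by_contra hab
    obtain ⟨-, C, β, hβ, -, hH⟩ := h𝒟.2 hh
    obtain ⟨t, rfl⟩ := eq_toCirc_of_conj hα hc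
    exact hq.not_holderWith (frequently_interleave hab) t hβ hH

end CircleConj

theorem mainTheorem3 (α : ℝ) (hα : Liouville α) :
    ∃ Ψ : (ℕ → Bool) → CircleConj.SmoothDiffeoRot (α : CircleConj.Circ),
      Continuous Ψ ∧
      ∀ 𝒟 : Set (CircleConj.Circ ≃ₜ CircleConj.Circ), CircleConj.IsRegularityClass 𝒟 →
        CircleConj.Reduces CircleConj.E₀ (CircleConj.conjRel 𝒟 (α : CircleConj.Circ)) Ψ := by
  obtain ⟨q, hq⟩ := CircleConj.exists_goodSeq hα
  exact ⟨_, hq.continuous_conjRotation, fun 𝒟 h𝒟 => hq.reduces hα.irrational h𝒟⟩
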